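/- Let $p$ be a prime, let $e,m,k,d\ge 1$ be integers, let $q=p^e$, and let $\mathbb{F}_{q^m}$ be the finite field with $q^m$ elements. For $f\in\mathbb{F}_{q^m}[x_1,\ldots,x_k]$ let $N(f=y^q-y)$ denote the number of $(x_1,\ldots,x_k,y)\in\mathbb{F}_{q^m}^{k+1}$ with $f(x_1,\ldots,x_k)=y^q-y$, and let $\nu_p$ be the $p$-adic valuation. Put $g=\gcd\left(d,\frac{q^m-1}{q-1}\right)$. Then for every homogeneous polynomial $f\in\mathbb{F}_{q^m}[x_1,\ldots,x_k]$ of degree $d$ (the zero polynomial included), $$\nu_p\bigl(N(f=y^q-y)\bigr)\ \ge\ \left\lceil \frac{em}{g}\left\lceil\frac{g\,k}{d}\right\rceil\right\rceil .$$ If $g=1$, then for every homogeneous polynomial $f\in\mathbb{F}_{q^m}[x_1,\ldots,x_k]$ of degree $d$, $$\nu_p\bigl(N(f=y^q-y)\bigr)\ \ge\ em\left\lceil\frac{k}{d}\right\rceil ,$$ and there exists a nonzero homogeneous polynomial $f\in\mathbb{F}_{q^m}[x_1,\ldots,x_k]$ of degree $d$ for which equality holds. -/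

import Mathlib

/-- `N(f = y^q - y)`: the number of solutions `(x, y) ∈ F^k × F` of `f(x) = y^q - y`. -/
noncomputable def artinSchreierCount {F : Type*} [Field F] {k : ℕ} (q : ℕ)
    (f : MvPolynomial (Fin k) F) : ℕ :=
  Nat.card {v : (Fin k → F) × F // MvPolynomial.eval v.1 f = v.2 ^ q - v.2}

/-! Let `Q = q ^ m = p ^ f` be the number of elements of `F`, let `M = (Q - 1) / (q - 1)` and let
`ψ = ζ ^ Tr` for a primitive `p`-th root of unity `ζ`. As `ψ (x ^ q) = ψ x`, summing over `y` shows
that the point count `N` is the sum of the exponential sums `S t = ∑ x, ψ (t * P x)` over the `t`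
with `t ^ q = t`. Homogeneity gives `S (t * v ^ d) = S t`, and the nonzero such `t` are the `M`-th
powers, so the sum spreads out to one over the powers `s ^ g` with `g = gcd d M`:
`M * N + Q ^ k = M * Q ^ k + ∑ s, S (s ^ g)`.

Work in a valuation ring of `ℂ` above `p`. Fourier inversion writes `ψ` as a polynomial in the
Teichmüller character `ω`, whose `j`-th coefficient is, by the lower bound of Stickelberger's
theorem, divisible by `(ζ - 1) ^ r`, with `r` the sum of the base `p` digits of `j`. In the
expansion of `∑ s, S (s ^ g)` only exponents divisible by `Q - 1` survive; rotating base `p` digits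
and averaging bounds the digit sums of these from below, as in Moreno and Moreno's proof of the
theorem of Ax and Katz. Since `(ζ - 1) ^ (p - 1)` is associated to `p`, this bounds the valuation
of `N`.

If `g = 1`, the relation says that `N` is governed by the number of zeros of `P`, and sums of
monomials in disjoint sets of variables attain the bound of Ax and Katz for that number. -/

section Digits

variable {p : ℕ}

theorem sum_digits_eq_mod_add_sum_digits_div (hp : 1 < p) (j : ℕ) :
    (p.digits j).sum = j % p + (p.digits (j / p)).sum := by
  rcases j.eq_zero_or_pos with rfl | hj
  · simp
  · rw [Nat.digits_def' hp hj, List.sum_cons]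

theorem sum_digits_mul_left (hp : 1 < p) (j : ℕ) :
    (p.digits (p * j)).sum = (p.digits j).sum := by
  rw [sum_digits_eq_mod_add_sum_digits_div hp, Nat.mul_mod_right, zero_add,
    Nat.mul_div_cancel_left _ (zero_lt_one.trans hp)]

theorem sum_digits_succ (hp : 1 < p) {j : ℕ} (hj : ¬p ∣ j + 1) :
    (p.digits (j + 1)).sum = (p.digits j).sum + 1 := by
  have hmod : (j + 1) % p = j % p + 1 := by
    have hlt : j % p + 1 < p := by
      refine lt_of_le_of_ne (Nat.mod_lt j (by lia)) fun h => hj ?_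
      rw [Nat.dvd_iff_mod_eq_zero, ← Nat.mod_add_mod, h, Nat.mod_self]
    rw [← Nat.mod_add_mod, Nat.mod_eq_of_lt hlt]
  rw [sum_digits_eq_mod_add_sum_digits_div hp, Nat.succ_div_of_not_dvd hj, hmod,
    sum_digits_eq_mod_add_sum_digits_div hp j, add_right_comm]

theorem sum_digits_add_sum_digits_of_add_add_one_eq (hp : 1 < p) {f a b : ℕ}
    (h : a + b + 1 = p ^ f) : (p.digits a).sum + (p.digits b).sum = f * (p - 1) := by
  induction f generalizing a b with
  | zero =>
    obtain ⟨rfl, rfl⟩ : a = 0 ∧ b = 0 := by rw [pow_zero] at h; lia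
    simp
  | succ f ih =>
    rw [pow_succ'] at h
    have hdiv : a / p + b / p + 1 = p ^ f := by
      have hle : b / p < p ^ f := Nat.div_lt_of_lt_mul (by lia)
      have := Nat.mul_sub_div b p (p ^ f) (by lia)
      rw [← h, show a + b + 1 - (b + 1) = a by lia] at this
      lia
    have hmod : a % p + b % p = p - 1 := by
      have hmul : p * (a / p) + p * (b / p) + p = p * p ^ f := by rw [← hdiv]; ring
      have := Nat.div_add_mod a p
      have := Nat.div_add_mod b p
      lia
    rw [sum_digits_eq_mod_add_sum_digits_div hp a, sum_digits_eq_mod_add_sum_digits_div hp b,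
      add_add_add_comm, hmod, ih hdiv, add_one_mul, add_comm]

theorem sub_one_mul_sum_div_pow_add_sum_digits (hp : 1 < p) {f j : ℕ} (hj : j < p ^ f) :
    (p - 1) * ∑ i ∈ Finset.range f, j / p ^ (i + 1) + (p.digits j).sum = j := by
  rcases eq_or_ne j 0 with rfl | hj0
  · simp
  have hsum : ∑ i ∈ Finset.range (p.log j).succ, j / p ^ i.succ =
      ∑ i ∈ Finset.range f, j / p ^ (i + 1) := by
    refine Finset.sum_subset (Finset.range_mono (Nat.log_lt_of_lt_pow hj0 hj)) fun i _ hi => ?_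
    rw [Finset.mem_range, not_lt] at hi
    exact Nat.div_eq_of_lt (Nat.lt_pow_of_log_lt hp (Nat.lt_succ_of_lt hi))
  rw [← hsum, Nat.sub_one_mul_sum_log_div_pow_eq_sub_sum_digits,
    Nat.sub_add_cancel (Nat.digit_sum_le p j)]

/-- Rotation by `r` places of the base `p` expansion of `j`, written with `f` digits. -/
def rotateDigits (p f r j : ℕ) : ℕ :=
  p ^ r * (j % p ^ (f - r)) + j / p ^ (f - r)

theorem rotateDigits_add (hp : p ≠ 0) {f r : ℕ} (hr : r ≤ f) (j : ℕ) :
    rotateDigits p f r j + (p ^ f - 1) * (j / p ^ (f - r)) = p ^ r * j := by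
  have hdiv : j / p ^ (f - r) ≤ p ^ f * (j / p ^ (f - r)) :=
    Nat.le_mul_of_pos_left _ (pow_pos (Nat.pos_of_ne_zero hp) f)
  calc rotateDigits p f r j + (p ^ f - 1) * (j / p ^ (f - r))
      = p ^ r * (j % p ^ (f - r)) + p ^ f * (j / p ^ (f - r)) := by
        rw [rotateDigits, Nat.sub_one_mul]; lia
    _ = p ^ r * (j % p ^ (f - r) + p ^ (f - r) * (j / p ^ (f - r))) := by
        rw [← Nat.add_sub_cancel' hr, pow_add, Nat.add_sub_cancel_left]; ring
    _ = p ^ r * j := by rw [Nat.mod_add_div]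

theorem rotateDigits_modEq (hp : p ≠ 0) {f r : ℕ} (hr : r ≤ f) (j : ℕ) :
    rotateDigits p f r j ≡ p ^ r * j [MOD p ^ f - 1] := by
  rw [← rotateDigits_add hp hr]
  simp [Nat.ModEq]

theorem rotateDigits_eq_zero_iff (hp : p ≠ 0) {f r j : ℕ} :
    rotateDigits p f r j = 0 ↔ j = 0 := by
  refine ⟨fun h => ?_, fun h => by simp [rotateDigits, h]⟩
  simp only [rotateDigits, Nat.add_eq_zero_iff, mul_eq_zero, pow_ne_zero _ hp, false_or] at h
  rw [← Nat.mod_add_div j (p ^ (f - r)), h.1, h.2, mul_zero, add_zero]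

theorem sub_one_mul_sum_rotateDigits (hp : 1 < p) {f j : ℕ} (hj : j < p ^ f) :
    (p - 1) * ∑ r ∈ Finset.range f, rotateDigits p f r j = (p ^ f - 1) * (p.digits j).sum := by
  have hgeom : (p - 1) * ∑ r ∈ Finset.range f, p ^ r = p ^ f - 1 := by
    rw [Nat.geomSum_eq hp, Nat.mul_div_cancel']
    simpa only [one_pow] using Nat.sub_dvd_pow_sub_pow p 1 f
  have hreflect : ∑ r ∈ Finset.range f, j / p ^ (f - r) =
      ∑ i ∈ Finset.range f, j / p ^ (i + 1) := by
    rw [← Finset.sum_range_reflect]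
    refine Finset.sum_congr rfl fun r hr => ?_
    rw [show f - (f - 1 - r) = r + 1 by have := Finset.mem_range.1 hr; lia]
  have hsum : ∑ r ∈ Finset.range f, rotateDigits p f r j +
      (p ^ f - 1) * ∑ i ∈ Finset.range f, j / p ^ (i + 1) = (∑ r ∈ Finset.range f, p ^ r) * j := by
    rw [← hreflect, Finset.mul_sum, ← Finset.sum_add_distrib, Finset.sum_mul]
    exact Finset.sum_congr rfl fun r hr =>
      rotateDigits_add (by lia) (Finset.mem_range.1 hr).le j
  refine Nat.add_right_cancel (m := (p ^ f - 1) *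
    ((p - 1) * ∑ i ∈ Finset.range f, j / p ^ (i + 1))) ?_
  calc _ = (p - 1) * (∑ r ∈ Finset.range f, rotateDigits p f r j +
        (p ^ f - 1) * ∑ i ∈ Finset.range f, j / p ^ (i + 1)) := by ring
    _ = (p ^ f - 1) * j := by rw [hsum, ← mul_assoc, hgeom]
    _ = (p ^ f - 1) * ((p - 1) * ∑ i ∈ Finset.range f, j / p ^ (i + 1) + (p.digits j).sum) := by
        rw [sub_one_mul_sum_div_pow_add_sum_digits hp hj]
    _ = _ := by ring

end Digits

section Weights

variable {A ι : Type*} [Fintype A] [Fintype ι]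

theorem mul_ceilDiv_le_mul_sum_add {D d g : ℕ} (hD : 0 < D) (hd : 0 < d) {t : A → ℕ}
    {α : A → ι → ℕ} (hα : ∀ a, ∑ v, α a v = d) (hsum : D ∣ g * ∑ a, t a)
    (hcol : ∀ v, D ∣ ∑ a, t a * α a v) :
    D * ((g * Fintype.card ι) ⌈/⌉ d) ≤
      g * ∑ a, t a + D * (g * Fintype.card {v // ∑ a, t a * α a v = 0}) := by
  classical
  have hcount : D * Fintype.card {v // ∑ a, t a * α a v ≠ 0} ≤ d * ∑ a, t a := by
    calc D * Fintype.card {v // ∑ a, t a * α a v ≠ 0}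
        = ∑ v with ∑ a, t a * α a v ≠ 0, D := by
          rw [Finset.sum_const, smul_eq_mul, mul_comm, Fintype.card_subtype]
      _ ≤ ∑ v with ∑ a, t a * α a v ≠ 0, ∑ a, t a * α a v := Finset.sum_le_sum fun v hv =>
          Nat.le_of_dvd (Nat.pos_of_ne_zero (Finset.mem_filter.1 hv).2) (hcol v)
      _ = d * ∑ a, t a := by
          rw [Finset.sum_filter_ne_zero, Finset.sum_comm, Finset.mul_sum]
          exact Finset.sum_congr rfl fun a _ => by rw [← Finset.mul_sum, hα, mul_comm]
  obtain ⟨b, hb⟩ := hsum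
  rw [hb, ← mul_add]
  refine Nat.mul_le_mul_left _ ((ceilDiv_le_iff_le_mul hd).2 ?_)
  have hcard := Fintype.card_subtype_compl fun v => ∑ a, t a * α a v = 0
  have hle := Fintype.card_subtype_le fun v => ∑ a, t a * α a v = 0
  have hb' : g * Fintype.card {v // ∑ a, t a * α a v ≠ 0} ≤ d * b := by
    refine Nat.le_of_mul_le_mul_left ?_ hD
    calc D * (g * Fintype.card {v // ∑ a, t a * α a v ≠ 0})
        = g * (D * Fintype.card {v // ∑ a, t a * α a v ≠ 0}) := by ring
      _ ≤ g * (d * ∑ a, t a) := Nat.mul_le_mul_left _ hcount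
      _ = D * (d * b) := by rw [mul_left_comm, hb, mul_left_comm]
  calc g * Fintype.card ι = g * Fintype.card {v // ∑ a, t a * α a v ≠ 0} +
        g * Fintype.card {v // ∑ a, t a * α a v = 0} := by
        rw [← mul_add, hcard, Nat.sub_add_cancel hle]
    _ ≤ d * (b + g * Fintype.card {v // ∑ a, t a * α a v = 0}) := by
        rw [mul_add]
        exact Nat.add_le_add hb' (Nat.le_mul_of_pos_left _ hd)

theorem dvd_sum_rotateDigits_mul {p f r : ℕ} (hp : p ≠ 0) (hr : r ≤ f) {J c : A → ℕ}
    (h : p ^ f - 1 ∣ ∑ a, J a * c a) :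
    p ^ f - 1 ∣ ∑ a, rotateDigits p f r (J a) * c a := by
  have hmod : ∑ a, rotateDigits p f r (J a) * c a ≡ p ^ r * ∑ a, J a * c a [MOD p ^ f - 1] := by
    rw [Finset.mul_sum]
    refine Nat.ModEq.sum fun a _ => ?_
    rw [← mul_assoc]
    exact (rotateDigits_modEq hp hr _).mul_right _
  exact (hmod.dvd_iff dvd_rfl).2 (h.mul_left _)

-- Rotating the digits of all the `J a` preserves the congruences, so the bound for sums of the
-- `J a` holds for every rotation; averaging over the rotations turns it into one for digit sums.
theorem mul_ceilDiv_le_mul_sum_digits_add {p f d g : ℕ} (hp : 1 < p) (hd : 0 < d) {J : A → ℕ}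
    (hJ : ∀ a, J a < p ^ f) {α : A → ι → ℕ} (hα : ∀ a, ∑ v, α a v = d)
    (hsum : p ^ f - 1 ∣ g * ∑ a, J a) (hcol : ∀ v, p ^ f - 1 ∣ ∑ a, J a * α a v) :
    (p - 1) * f * ((g * Fintype.card ι) ⌈/⌉ d) ≤ g * (∑ a, (p.digits (J a)).sum +
      (p - 1) * f * Fintype.card {v // ∑ a, J a * α a v = 0}) := by
  have hp0 : p ≠ 0 := by lia
  rcases eq_or_ne f 0 with rfl | hf
  · simp
  have hD : 0 < p ^ f - 1 := Nat.sub_pos_of_lt (Nat.one_lt_pow hf hp)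
  generalize hW : (g * Fintype.card ι) ⌈/⌉ d = W
  generalize hV : Fintype.card {v // ∑ a, J a * α a v = 0} = V
  have hrotate : ∀ r ∈ Finset.range f, (p ^ f - 1) * W ≤
      g * ∑ a, rotateDigits p f r (J a) + (p ^ f - 1) * (g * V) := fun r hr => by
    have hr' := (Finset.mem_range.1 hr).le
    have hsum' := dvd_sum_rotateDigits_mul (c := fun _ => g) hp0 hr'
      (by rwa [← Finset.sum_mul, mul_comm])
    rw [← Finset.sum_mul, mul_comm] at hsum'
    have h := mul_ceilDiv_le_mul_sum_add hD hd hα hsum' fun v =>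
      dvd_sum_rotateDigits_mul hp0 hr' (hcol v)
    simpa only [Finset.sum_eq_zero_iff, mul_eq_zero, rotateDigits_eq_zero_iff hp0, hW, hV,
      ← hV] using h
  have hdigits : (p - 1) * ∑ r ∈ Finset.range f, ∑ a, rotateDigits p f r (J a) =
      (p ^ f - 1) * ∑ a, (p.digits (J a)).sum := by
    rw [Finset.sum_comm, Finset.mul_sum, Finset.mul_sum]
    exact Finset.sum_congr rfl fun a _ => sub_one_mul_sum_rotateDigits hp (hJ a)
  refine Nat.le_of_mul_le_mul_left ?_ hD
  calc (p ^ f - 1) * ((p - 1) * f * W) = (p - 1) * ∑ _r ∈ Finset.range f, (p ^ f - 1) * W := by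
        rw [Finset.sum_const, Finset.card_range, smul_eq_mul]; ring
    _ ≤ (p - 1) * ∑ r ∈ Finset.range f,
          (g * ∑ a, rotateDigits p f r (J a) + (p ^ f - 1) * (g * V)) :=
        Nat.mul_le_mul_left _ (Finset.sum_le_sum hrotate)
    _ = g * ((p - 1) * ∑ r ∈ Finset.range f, ∑ a, rotateDigits p f r (J a)) +
          (p ^ f - 1) * (g * ((p - 1) * f * V)) := by
        rw [Finset.sum_add_distrib, Finset.sum_const, Finset.card_range, smul_eq_mul,
          ← Finset.mul_sum]; ring
    _ = _ := by rw [hdigits]; ring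

end Weights

section TraceCharacter

/-- The additive character `x ↦ ζ ^ Tr(x)` of a field of characteristic `p`. -/
noncomputable def traceChar (F : Type*) {R : Type*} [Field F] [CommRing R] {p : ℕ}
    [Fact p.Prime] [Algebra (ZMod p) F] {ζ : R} (hζ : ζ ^ p = 1) : AddChar F R :=
  (AddChar.zmodChar p hζ).compAddMonoidHom (Algebra.trace (ZMod p) F).toAddMonoidHom

variable {F R : Type*} [Field F] [CommRing R] {p : ℕ} [hp : Fact p.Prime] [Algebra (ZMod p) F]
  {ζ : R}

theorem traceChar_apply (hζ : ζ ^ p = 1) (x : F) :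
    traceChar F hζ x = ζ ^ (Algebra.trace (ZMod p) F x).val := by
  simp [traceChar, AddChar.zmodChar_apply]

theorem traceChar_pow_char [Finite F] (hζ : ζ ^ p = 1) (x : F) :
    traceChar F hζ (x ^ p) = traceChar F hζ x := by
  have h := Algebra.trace_eq_of_algEquiv
    (FiniteField.frobeniusAlgEquivOfAlgebraic (ZMod p) F) x
  rw [FiniteField.coe_frobeniusAlgEquivOfAlgebraic, ZMod.card] at h
  rw [traceChar_apply, traceChar_apply, h]

theorem traceChar_pow_char_pow [Finite F] (hζ : ζ ^ p = 1) (n : ℕ) (x : F) :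
    traceChar F hζ (x ^ p ^ n) = traceChar F hζ x := by
  induction n with
  | zero => simp
  | succ n ih => rw [pow_succ, pow_mul, traceChar_pow_char, ih]

theorem traceChar_ne_one [Finite F] (hζ : IsPrimitiveRoot ζ p) :
    traceChar F hζ.pow_eq_one ≠ 1 := by
  obtain ⟨x, hx⟩ := Algebra.trace_surjective (ZMod p) F 1
  refine AddChar.ne_one_iff.2 ⟨x, ?_⟩
  rw [traceChar_apply, hx, ZMod.val_one, pow_one]
  exact hζ.ne_one hp.out.one_lt

theorem traceChar_isPrimitive [Finite F] (hζ : IsPrimitiveRoot ζ p) :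
    (traceChar F hζ.pow_eq_one).IsPrimitive :=
  AddChar.IsPrimitive.of_ne_one (traceChar_ne_one hζ)

theorem gaussSum_pow_char_traceChar [Fintype F] (hζ : ζ ^ p = 1) (χ : MulChar F R) :
    gaussSum (χ ^ p) (traceChar F hζ) = gaussSum χ (traceChar F hζ) := by
  have : CharP F p := charP_of_injective_algebraMap (algebraMap (ZMod p) F).injective p
  have : ExpChar F p := ExpChar.prime hp.out
  rw [gaussSum, gaussSum, ← (Equiv.ofBijective _ (bijective_frobenius F p)).sum_comp
    fun x => χ x * _]
  refine Finset.sum_congr rfl fun x _ => ?_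
  rw [Equiv.ofBijective_apply, frobenius_def, traceChar_pow_char,
    MulChar.pow_apply' _ hp.out.ne_zero, map_pow]

end TraceCharacter

section FiniteFieldSums

theorem sum_eq_apply_zero_add_sum_units {F A : Type*} [GroupWithZero F] [Fintype F] [Fintype Fˣ]
    [AddCommMonoid A] (h : F → A) : ∑ x, h x = h 0 + ∑ u : Fˣ, h u := by
  classical
  rw [Fintype.sum_eq_add_sum_subtype_ne h 0, ← unitsEquivNeZero.sum_comp]
  rfl

theorem sum_inv_mul_algebraMap_trace (K : Type*) {L : Type*} [Field K] [Field L] [Fintype L]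
    [Algebra K L] : ∑ x : L, x⁻¹ * algebraMap K L (Algebra.trace K L x) = -1 := by
  classical
  have : Finite K := Finite.of_injective _ (algebraMap K L).injective
  have hK : 1 < Nat.card K := Finite.one_lt_card
  have hL : Fintype.card L = Nat.card K ^ Module.finrank K L := by
    rw [← Nat.card_eq_fintype_card, Module.natCard_eq_pow_finrank (K := K)]
  have hterm : ∀ u : Lˣ, (u : L)⁻¹ * algebraMap K L (Algebra.trace K L u) =
      ∑ i ∈ Finset.range (Module.finrank K L), (u ^ (Nat.card K ^ i - 1) : L) := fun u => by
    rw [FiniteField.algebraMap_trace_eq_sum_pow, Finset.mul_sum]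
    refine Finset.sum_congr rfl fun i _ => ?_
    rw [inv_mul_eq_iff_eq_mul₀ u.ne_zero, ← pow_succ',
      Nat.sub_add_cancel (Nat.one_le_pow _ _ (by lia))]
  rw [sum_eq_apply_zero_add_sum_units, inv_zero, zero_mul, zero_add, Fintype.sum_congr _ _ hterm,
    Finset.sum_comm, Finset.sum_eq_single_of_mem 0 (Finset.mem_range.2 Module.finrank_pos)]
  · rw [FiniteField.sum_pow_units, if_pos (by simp)]
  · intro i hi hi0
    rw [FiniteField.sum_pow_units, if_neg]
    have hlt : Nat.card K ^ i < Nat.card K ^ Module.finrank K L :=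
      Nat.pow_lt_pow_right hK (Finset.mem_range.1 hi)
    have hone : 1 < Nat.card K ^ i := Nat.one_lt_pow hi0 hK
    exact Nat.not_dvd_of_pos_of_lt (by lia) (by lia)

variable {F R : Type*} [Field F] [Fintype F] [CommRing R] {ω : MulChar F R}

theorem pow_ne_one_of_injective (hω : Function.Injective ω) {n : ℕ}
    (hn : ¬Fintype.card F - 1 ∣ n) : ω ^ n ≠ 1 := by
  refine fun h => hn ((FiniteField.forall_pow_eq_one_iff F n).1 fun x => Units.ext (hω ?_))
  simpa only [MulChar.pow_apply_coe, MulChar.one_apply_coe, ← map_pow, ← map_one ω,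
    Units.val_pow_eq_pow_val, Units.val_one] using
    congrArg (fun χ : MulChar F R => χ x) h

theorem inv_pow_ne_one_of_injective (hω : Function.Injective ω) {n : ℕ}
    (hn : ¬Fintype.card F - 1 ∣ n) : ω⁻¹ ^ n ≠ 1 := by
  rw [inv_pow, inv_ne_one]
  exact pow_ne_one_of_injective hω hn

variable [IsDomain R]

theorem sum_pow_eq_zero_of_injective (hω : Function.Injective ω) {n : ℕ}
    (hn : ¬Fintype.card F - 1 ∣ n) : ∑ x, ω x ^ n = 0 := by
  have hn0 : n ≠ 0 := by rintro rfl; exact hn (dvd_zero _)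
  simpa only [MulChar.pow_apply' ω hn0] using
    MulChar.sum_eq_zero_of_ne_one (pow_ne_one_of_injective hω hn)

theorem sum_range_pow_succ_of_injective [DecidableEq F] (hω : Function.Injective ω) (z : F) :
    ∑ j ∈ Finset.range (Fintype.card F - 1), ω z ^ (j + 1) =
      if z = 1 then (Fintype.card F : R) - 1 else 0 := by
  rcases eq_or_ne z 1 with rfl | hz1
  · simp [Nat.cast_sub Fintype.card_pos]
  rw [if_neg hz1]
  rcases eq_or_ne z 0 with rfl | hz0
  · simp [MulChar.map_zero]
  have hgeom := geom_sum_mul (ω z) (Fintype.card F - 1)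
  rw [← map_pow, FiniteField.pow_card_sub_one_eq_one z hz0, map_one, sub_self, mul_eq_zero,
    sub_eq_zero, ← map_one ω, hω.eq_iff, or_iff_left hz1] at hgeom
  simp only [pow_succ, ← Finset.sum_mul, hgeom, zero_mul]

-- Fourier inversion on the group of units of `F`.
theorem sum_gaussSum_inv_pow_mul_pow [DecidableEq F] (hω : Function.Injective ω)
    (ψ : AddChar F R) (x : F) :
    ∑ j ∈ Finset.range (Fintype.card F - 1), gaussSum (ω⁻¹ ^ (j + 1)) ψ * ω x ^ (j + 1) =
      if x = 0 then 0 else ((Fintype.card F : R) - 1) * ψ x := by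
  have hterm : ∀ j y, (ω⁻¹ ^ (j + 1)) y * ψ y * ω x ^ (j + 1) =
      ω (y⁻¹ * x) ^ (j + 1) * ψ y := fun j y => by
    rw [MulChar.pow_apply' _ j.add_one_ne_zero, MulChar.inv_apply', map_mul, mul_pow]
    ring
  simp only [gaussSum, Finset.sum_mul, hterm]
  rw [Finset.sum_comm]
  simp only [← Finset.sum_mul, sum_range_pow_succ_of_injective hω]
  rcases eq_or_ne x 0 with rfl | hx
  · simp
  · have hiff : ∀ y, y⁻¹ * x = 1 ↔ y = x := fun y => by
      rcases eq_or_ne y 0 with rfl | hy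
      · simp [hx.symm]
      · exact inv_mul_eq_one₀ hy
    simp only [hiff, hx, if_false, ite_mul, zero_mul, Finset.sum_ite_eq', Finset.mem_univ, if_true]

theorem apply_eq_sum_gaussSum_inv_pow (hω : Function.Injective ω) (ψ : AddChar F R) {u : Rˣ}
    (hu : (u : R) = Fintype.card F - 1) (x : F) :
    ψ x = ∑ j ∈ Finset.range (Fintype.card F), (if j = 0 then 1 else
      ↑u⁻¹ * gaussSum (ω⁻¹ ^ j) ψ - if j = Fintype.card F - 1 then 1 else 0) * ω x ^ j := by
  classical
  have hcard := Fintype.one_lt_card (α := F)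
  have hfourier := sum_gaussSum_inv_pow_mul_pow hω ψ x
  rw [← hu] at hfourier
  obtain ⟨n, hn⟩ : ∃ n, Fintype.card F = n + 2 := ⟨Fintype.card F - 2, by lia⟩
  rw [show Fintype.card F - 1 = n + 1 by lia] at hfourier ⊢
  rw [hn, Finset.sum_range_succ']
  simp only [Nat.add_one_ne_zero, if_false, if_true, sub_mul, Finset.sum_sub_distrib, mul_assoc,
    ← Finset.mul_sum, hfourier, ite_mul, one_mul, zero_mul, Nat.add_right_cancel_iff,
    Finset.sum_ite_eq', Finset.mem_range, Nat.lt_succ_self, pow_zero]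
  rcases eq_or_ne x 0 with rfl | hx
  · simp [MulChar.map_zero]
  · rw [if_neg hx, Units.inv_mul_cancel_left, ← map_pow, show n + 1 = Fintype.card F - 1 by lia,
      FiniteField.pow_card_sub_one_eq_one x hx, map_one, sub_add_cancel]

end FiniteFieldSums

section Stickelberger

open IsLocalRing

theorem associated_sub_one_pow_prime {R : Type*} [CommRing R] [IsDomain R] {p : ℕ}
    (hp : p.Prime) {ζ : R} (hζ : IsPrimitiveRoot ζ p) :
    Associated ((ζ - 1) ^ (p - 1)) (p : R) := by
  obtain ⟨n, rfl⟩ : ∃ n, p = n + 1 := ⟨p - 1, by have := hp.one_lt; lia⟩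
  have hprod : Associated (∏ _k ∈ Finset.range n, (ζ - 1))
      (∏ k ∈ Finset.range n, (ζ ^ (k + 1) - 1)) := by
    refine Associated.prod _ _ _ fun k hk => hζ.associated_sub_one_pow_sub_one_of_coprime ?_
    have := Finset.mem_range.1 hk
    exact (Nat.coprime_of_lt_prime (by lia) (by lia) hp).symm
  rw [Finset.prod_const, Finset.card_range] at hprod
  rw [Nat.add_sub_cancel, Nat.cast_add, Nat.cast_one, ← hζ.prod_pow_sub_one_eq_order]
  exact hprod.trans (associated_unit_mul_right _ _ (isUnit_one.neg.pow n))

theorem associated_sub_one_pow_prime_pow {R : Type*} [CommRing R] [IsDomain R] {p : ℕ}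
    (hp : p.Prime) {ζ : R} (hζ : IsPrimitiveRoot ζ p) (f : ℕ) :
    Associated ((ζ - 1) ^ (f * (p - 1))) ((p ^ f : ℕ) : R) := by
  rw [Nat.cast_pow, mul_comm, pow_mul]
  exact (associated_sub_one_pow_prime hp hζ).pow_pow

theorem residue_eq_one_of_pow_char_eq_one {R : Type*} [CommRing R] [IsLocalRing R] {p : ℕ}
    [Fact p.Prime] [CharP (ResidueField R) p] {ζ : R} (hζ : ζ ^ p = 1) : residue R ζ = 1 := by
  have : ExpChar (ResidueField R) p := ExpChar.prime Fact.out
  refine frobenius_inj (ResidueField R) p ?_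
  rw [frobenius_def, ← map_pow, hζ, map_one, map_one]

variable {F R : Type*} [Field F] [CommRing R] [IsLocalRing R]

theorem isUnit_natCast_card_sub_one [Fintype F] (ι : F →+* ResidueField R) :
    IsUnit ((Fintype.card F : R) - 1) := by
  rw [← residue_ne_zero_iff_isUnit, map_sub, map_natCast, map_one, ← map_natCast ι,
    FiniteField.cast_card_eq_zero, map_zero, zero_sub]
  exact neg_ne_zero.2 one_ne_zero

/-- `ω` is a Teichmüller character of `F`, with respect to an embedding `ι` of `F` into the residue
field of `R`: its values lift those of `ι`. -/
def IsTeichmullerChar (ω : MulChar F R) (ι : F →+* ResidueField R) : Prop :=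
  ∀ x, residue R (ω x) = ι x

variable {ι : F →+* ResidueField R} {ω : MulChar F R}

theorem IsTeichmullerChar.injective (hω : IsTeichmullerChar ω ι) : Function.Injective ω :=
  fun x y h => ι.injective (by rw [← hω, ← hω, h])

variable {p : ℕ} [hp : Fact p.Prime] [Algebra (ZMod p) F] {ζ : R}

theorem exists_traceChar_eq_one_add_mul (ι : F →+* ResidueField R) (hζ : ζ ^ p = 1) (x : F) :
    ∃ y, traceChar F hζ x = 1 + (ζ - 1) * y ∧
      residue R y = ι (algebraMap (ZMod p) F (Algebra.trace (ZMod p) F x)) := by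
  have : CharP F p := charP_of_injective_algebraMap (algebraMap (ZMod p) F).injective p
  have : CharP (ResidueField R) p := charP_of_injective_ringHom ι.injective p
  refine ⟨∑ i ∈ Finset.range (Algebra.trace (ZMod p) F x).val, ζ ^ i, ?_, ?_⟩
  · rw [mul_geom_sum, traceChar_apply, add_sub_cancel]
  · simp only [map_sum, map_pow, residue_eq_one_of_pow_char_eq_one hζ, one_pow, Finset.sum_const,
      Finset.card_range, nsmul_one]
    conv_rhs => rw [← ZMod.natCast_zmod_val (Algebra.trace (ZMod p) F x), map_natCast, map_natCast]

variable [Fintype F] [IsDomain R]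

-- Modulo the maximal ideal, the quotient of the Gauss sum by `ζ - 1` is `∑ x, x⁻¹ * Tr x = -1`.
theorem associated_gaussSum_inv (hω : IsTeichmullerChar ω ι) (hζ : ζ ^ p = 1)
    (hF : 2 < Fintype.card F) : Associated (ζ - 1) (gaussSum ω⁻¹ (traceChar F hζ)) := by
  choose y hy hres using exists_traceChar_eq_one_add_mul ι hζ
  have hne : ω⁻¹ ≠ 1 := by
    simpa only [pow_one] using
      inv_pow_ne_one_of_injective hω.injective (n := 1) (by rw [Nat.dvd_one]; lia)
  have hsum : gaussSum ω⁻¹ (traceChar F hζ) = (ζ - 1) * ∑ x, ω⁻¹ x * y x := by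
    simp only [gaussSum, hy, mul_add, mul_one, Finset.sum_add_distrib,
      MulChar.sum_eq_zero_of_ne_one hne, zero_add, Finset.mul_sum, mul_left_comm]
  have hunit : residue R (∑ x, ω⁻¹ x * y x) = -1 := by
    rw [← map_one ι, ← map_neg, ← sum_inv_mul_algebraMap_trace (ZMod p)]
    simp only [map_sum, map_mul, hres, MulChar.inv_apply', hω _]
  rw [hsum]
  refine associated_mul_unit_right _ _ ((residue_ne_zero_iff_isUnit _).1 ?_)
  rw [hunit]
  exact neg_ne_zero.2 one_ne_zero

theorem gaussSum_inv_pow_dvd (hω : IsTeichmullerChar ω ι) (hζ : IsPrimitiveRoot ζ p) {a : ℕ}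
    (ha : a < Fintype.card F - 1) :
    gaussSum (ω⁻¹ ^ a) (traceChar F hζ.pow_eq_one) ∣ (ζ - 1) ^ (p.digits a).sum := by
  have hp1 := hp.out.one_lt
  induction a using Nat.strong_induction_on with
  | _ a ih =>
    rcases a with _ | b
    · rw [pow_zero, gaussSum_one_left (traceChar_ne_one hζ)]
      simp
    by_cases hdvd : p ∣ b + 1
    · obtain ⟨c, hc⟩ := hdvd
      have hlt : c < b + 1 := by
        rw [hc]
        exact lt_mul_left (Nat.pos_of_ne_zero (by rintro rfl; simp at hc)) hp1
      rw [hc, sum_digits_mul_left hp1, mul_comm, pow_mul, gaussSum_pow_char_traceChar]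
      exact ih c hlt (hlt.trans ha)
    · have hjacobi := jacobiSum_mul_nontrivial (χ := ω⁻¹ ^ b) (φ := ω⁻¹)
        (by rw [← pow_succ]
            exact inv_pow_ne_one_of_injective hω.injective
              (Nat.not_dvd_of_pos_of_lt b.succ_pos ha))
        (traceChar F hζ.pow_eq_one)
      rw [sum_digits_succ hp1 hdvd, pow_succ, pow_succ]
      exact (Dvd.intro _ hjacobi).trans (mul_dvd_mul (ih b (by lia) (by lia))
        (associated_gaussSum_inv hω hζ.pow_eq_one (by lia)).symm.dvd)

theorem pow_sum_digits_dvd_gaussSum (hω : IsTeichmullerChar ω ι) (hζ : IsPrimitiveRoot ζ p)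
    {f a : ℕ} (hF : Fintype.card F = p ^ f) (ha0 : a ≠ 0) (ha : a < Fintype.card F - 1) :
    (ζ - 1) ^ (p.digits a).sum ∣ gaussSum (ω⁻¹ ^ a) (traceChar F hζ.pow_eq_one) := by
  classical
  set ψ := traceChar F hζ.pow_eq_one
  obtain ⟨b, hb⟩ : ∃ b, a + b + 1 = p ^ f := ⟨p ^ f - 1 - a, by lia⟩
  have hinv : (ω⁻¹ ^ a)⁻¹ = ω⁻¹ ^ b := by
    refine inv_eq_of_mul_eq_one_right ?_
    rw [← pow_add, show a + b = Fintype.card Fˣ by rw [Fintype.card_units]; lia]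
    exact MulChar.pow_card_eq_one _
  have hprod := gaussSum_mul_gaussSum_eq_card (inv_pow_ne_one_of_injective hω.injective
    (Nat.not_dvd_of_pos_of_lt (Nat.pos_of_ne_zero ha0) ha)) (traceChar_isPrimitive hζ)
  rw [hinv] at hprod
  have hupper : gaussSum (ω⁻¹ ^ b) ψ⁻¹ ∣ (ζ - 1) ^ (p.digits b).sum := by
    refine (Dvd.intro_left ((ω⁻¹ ^ b) (-1)) ?_).trans (gaussSum_inv_pow_dvd hω hζ (by lia))
    exact mul_gaussSum_inv_eq_gaussSum _ _
  have hdvd : (ζ - 1) ^ (f * (p - 1)) ∣ gaussSum (ω⁻¹ ^ a) ψ * (ζ - 1) ^ (p.digits b).sum := by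
    refine (associated_sub_one_pow_prime_pow hp.out hζ f).dvd.trans ?_
    rw [← hF, ← hprod]
    exact mul_dvd_mul_left _ hupper
  rw [← sum_digits_add_sum_digits_of_add_add_one_eq hp.out.one_lt hb, pow_add] at hdvd
  exact (mul_dvd_mul_iff_right (pow_ne_zero _ (sub_ne_zero.2 (hζ.ne_one hp.out.one_lt)))).1 hdvd

theorem exists_traceChar_eq_sum (hω : IsTeichmullerChar ω ι) (hζ : IsPrimitiveRoot ζ p) {f : ℕ}
    (hF : Fintype.card F = p ^ f) :
    ∃ c : ℕ → R, (∀ j < Fintype.card F, (ζ - 1) ^ (p.digits j).sum ∣ c j) ∧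
      ∀ x : F, traceChar F hζ.pow_eq_one x =
        ∑ j ∈ Finset.range (Fintype.card F), c j * ω x ^ j := by
  obtain ⟨u, hu⟩ := isUnit_natCast_card_sub_one (R := R) ι
  refine ⟨_, fun j hj => ?_, apply_eq_sum_gaussSum_inv_pow hω.injective _ hu⟩
  rcases eq_or_ne j 0 with rfl | hj0
  · simp
  rcases eq_or_ne j (Fintype.card F - 1) with hjn | hjn
  · have hone : ω⁻¹ ^ j = 1 := by
      classical rw [← MulChar.pow_card_eq_one ω⁻¹, Fintype.card_units, hjn]
    have hsum := sum_digits_add_sum_digits_of_add_add_one_eq hp.out.one_lt (a := j) (b := 0)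
      (f := f) (by lia)
    rw [Nat.digits_zero, List.sum_nil, add_zero] at hsum
    have hcoeff : (↑u⁻¹ * -1 - 1 : R) = -↑u⁻¹ * Fintype.card F := by
      rw [← sub_add_cancel (Fintype.card F : R) 1, ← hu, mul_add, neg_mul, Units.inv_mul]
      ring
    rw [if_neg hj0, if_pos hjn, hone, gaussSum_one_left (traceChar_ne_one hζ), hcoeff, hsum, hF]
    exact (associated_sub_one_pow_prime_pow hp.out hζ f).dvd.mul_left _
  · rw [if_neg hj0, if_neg hjn, sub_zero]
    exact (pow_sum_digits_dvd_gaussSum hω hζ hF hj0 (by lia)).mul_left _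

end Stickelberger

section TeichmullerLift

open IsLocalRing Polynomial

theorem exists_valuationSubring_not_isUnit_natCast (K : Type*) [Field K] [CharZero K] {n : ℕ}
    (hn : n ≠ 1) : ∃ A : ValuationSubring K, ¬IsUnit (n : A) := by
  let Z := (Int.castRingHom K).range
  have hproper : Ideal.span {(n : Z)} ≠ ⊤ := by
    rw [Ne, Ideal.span_singleton_eq_top, isUnit_iff_exists_inv]
    rintro ⟨⟨_, m, rfl⟩, hm⟩
    have hmul : ((n : ℤ) * m : K) = 1 := by simpa using congrArg Subtype.val hm
    have hmul' : (n : ℤ) * m = 1 := mod_cast hmul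
    have hunit := Int.isUnit_iff.1 (IsUnit.of_mul_eq_one m hmul')
    lia
  obtain ⟨A, -, hA⟩ := Ideal.image_subset_nonunits_valuationSubring _ hproper
  have hmem : (n : K) ∈ A.nonunits := hA ⟨n, Ideal.mem_span_singleton_self _, by simp⟩
  exact ⟨A, fun h => (A.mem_nonunits_iff.1 hmem).ne (by simpa using (A.valuation_eq_one_iff _).1 h)⟩

theorem mem_valuationSubring_of_pow_eq_one {K : Type*} [Field K] (A : ValuationSubring K) {x : K}
    {n : ℕ} (hn : n ≠ 0) (hx : x ^ n = 1) : x ∈ A := by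
  rw [← A.valuation_le_one_iff]
  refine (((pow_eq_one_iff ..).1 ?_).resolve_right hn).le
  rw [← map_pow, hx, map_one]

theorem exists_isPrimitiveRoot_valuationSubring (A : ValuationSubring ℂ) {n : ℕ} (hn : n ≠ 0) :
    ∃ z : A, IsPrimitiveRoot z n :=
  have h := Complex.isPrimitiveRoot_exp n hn
  ⟨⟨_, mem_valuationSubring_of_pow_eq_one A hn h.pow_eq_one⟩,
    IsPrimitiveRoot.coe_submonoidClass_iff.1 h⟩

theorem isPrimitiveRoot_map_of_natCast_ne_zero {R S : Type*} [CommRing R] [IsDomain R]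
    [CommRing S] [IsDomain S] (φ : R →+* S) {z : R} {n : ℕ} (hz : IsPrimitiveRoot z n)
    (hn : (n : S) ≠ 0) : IsPrimitiveRoot (φ z) n := by
  have : NeZero (n : S) := ⟨hn⟩
  have hpos : 0 < n := Nat.pos_of_ne_zero (by rintro rfl; exact hn Nat.cast_zero)
  rw [← isRoot_cyclotomic_iff, ← map_cyclotomic n φ]
  exact (hz.isRoot_cyclotomic hpos).map

variable {F : Type*} [Field F] [Fintype F]

theorem nonempty_ringHom_of_isPrimitiveRoot {κ : Type*} [Field κ] {p : ℕ} [Fact p.Prime]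
    [CharP F p] [CharP κ p] {z : κ} (hz : IsPrimitiveRoot z (Fintype.card F - 1)) :
    Nonempty (F →+* κ) := by
  let := ZMod.algebra F p
  let := ZMod.algebra κ p
  have hfactor : (X : κ[X]) ^ Fintype.card F - X = X * (X ^ (Fintype.card F - 1) - 1) := by
    rw [mul_sub, ← pow_succ', Nat.sub_add_cancel Fintype.card_pos, mul_one]
  have hsplits : Splits
      (((X : (ZMod p)[X]) ^ Fintype.card F - X).map (algebraMap (ZMod p) κ)) := by
    rw [Polynomial.map_sub, Polynomial.map_pow, map_X, hfactor]
    exact Splits.X.mul (X_pow_sub_one_splits hz)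
  exact ⟨(IsSplittingField.lift F _ hsplits).toRingHom⟩

theorem exists_isTeichmullerChar {R : Type*} [CommRing R] [IsDomain R] [IsLocalRing R] {z : R}
    (hz : IsPrimitiveRoot z (Fintype.card F - 1)) (ι : F →+* ResidueField R) :
    ∃ ω : MulChar F R, IsTeichmullerChar ω ι := by
  classical
  have hcard : Fintype.card F - 1 ≠ 0 := by have := Fintype.one_lt_card (α := F); lia
  have : NeZero (Fintype.card F - 1) := ⟨hcard⟩
  have hzι : IsPrimitiveRoot (residue R z) (Fintype.card F - 1) := by
    refine isPrimitiveRoot_map_of_natCast_ne_zero _ hz ?_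
    rw [Nat.cast_sub Fintype.card_pos, ← map_natCast ι, FiniteField.cast_card_eq_zero, map_zero]
    simp
  obtain ⟨γ, hγ⟩ := IsCyclic.exists_generator (α := Fˣ)
  obtain ⟨i, -, hi⟩ := hzι.eq_pow_of_pow_eq_one (ξ := ι γ) (by
    rw [← map_pow, FiniteField.pow_card_sub_one_eq_one _ γ.ne_zero, map_one])
  let u : Rˣ := (hz.isUnit hcard).unit
  have hu : u ^ i ∈ rootsOfUnity (Fintype.card Fˣ) R := by
    have hpow : u ^ (Fintype.card F - 1) = 1 := Units.ext (by simpa [u] using hz.pow_eq_one)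
    rw [mem_rootsOfUnity, Fintype.card_units, ← pow_mul, mul_comm, pow_mul, hpow, one_pow]
  have hωγ : MulChar.ofRootOfUnity hu hγ γ = z ^ i := by
    simpa [u] using MulChar.ofRootOfUnity_spec hu hγ
  refine ⟨MulChar.ofRootOfUnity hu hγ, fun x => ?_⟩
  rcases eq_or_ne x 0 with rfl | hx
  · rw [MulChar.map_zero, map_zero, map_zero]
  obtain ⟨k, hk⟩ := mem_powers_iff_mem_zpowers.2 (hγ (Units.mk0 x hx))
  have hxγ : x = (γ : F) ^ k := by simpa using (congrArg Units.val hk).symm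
  rw [hxγ, map_pow, map_pow, map_pow, hωγ, map_pow, hi]

theorem exists_valuationSubring_isTeichmullerChar (F : Type*) [Field F] [Finite F] (p : ℕ)
    [hp : Fact p.Prime] [CharP F p] :
    ∃ (A : ValuationSubring ℂ) (ι : F →+* ResidueField A) (ω : MulChar F A) (ζ : A),
      IsTeichmullerChar ω ι ∧ IsPrimitiveRoot ζ p := by
  have := Fintype.ofFinite F
  obtain ⟨A, hA⟩ := exists_valuationSubring_not_isUnit_natCast ℂ hp.out.ne_one
  obtain ⟨ζ, hζ⟩ := exists_isPrimitiveRoot_valuationSubring A hp.out.ne_zero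
  obtain ⟨z, hz⟩ := exists_isPrimitiveRoot_valuationSubring A (n := Fintype.card F - 1)
    (by have := Fintype.one_lt_card (α := F); lia)
  have hpκ : (p : ResidueField A) = 0 := by
    rw [← map_natCast (residue A)]
    exact (residue_eq_zero_iff _).2 hA
  have : CharP (ResidueField A) p := (CharP.charP_iff_prime_eq_zero hp.out).2 hpκ
  have hcard : ((Fintype.card F - 1 : ℕ) : ResidueField A) ≠ 0 := by
    obtain ⟨n, -, hn⟩ := FiniteField.card F p
    rw [Nat.cast_sub Fintype.card_pos, hn, Nat.cast_pow, hpκ, zero_pow n.ne_zero]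
    simp
  obtain ⟨ι⟩ := nonempty_ringHom_of_isPrimitiveRoot (F := F) (p := p)
    (isPrimitiveRoot_map_of_natCast_ne_zero (residue A) hz hcard)
  obtain ⟨ω, hω⟩ := exists_isTeichmullerChar hz ι
  exact ⟨A, ι, ω, ζ, hω, hζ⟩

end TeichmullerLift

section ExponentialSums

theorem addChar_map_sum_eq_prod {A M ι : Type*} [AddCommMonoid A] [CommMonoid M]
    (ψ : AddChar A M) (s : Finset ι) (h : ι → A) : ψ (∑ i ∈ s, h i) = ∏ i ∈ s, ψ (h i) := by
  rw [← toAdd_ofAdd (∑ i ∈ s, h i), ofAdd_sum, ← AddChar.toMonoidHom_apply, map_prod]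
  simp only [AddChar.toMonoidHom_apply, toAdd_ofAdd]

theorem sum_apply_eq_of_mem_support {F σ : Type*} [CommSemiring F] [Fintype σ]
    {P : MvPolynomial σ F} {d : ℕ} (hP : P.IsHomogeneous d) {a : σ →₀ ℕ} (ha : a ∈ P.support) :
    ∑ v, a v = d := by
  rw [← Finsupp.degree_eq_sum]
  exact (hP.degree_eq_sum_deg_support ha).symm

theorem eval_smul_of_isHomogeneous {F σ : Type*} [CommSemiring F] [Finite σ]
    {P : MvPolynomial σ F} {d : ℕ} (hP : P.IsHomogeneous d) (c : F) (x : σ → F) :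
    MvPolynomial.eval (c • x) P = c ^ d * MvPolynomial.eval x P := by
  have := Fintype.ofFinite σ
  rw [MvPolynomial.eval_eq', MvPolynomial.eval_eq', Finset.mul_sum]
  refine Finset.sum_congr rfl fun a ha => ?_
  simp only [Pi.smul_apply, smul_eq_mul, mul_pow, Finset.prod_mul_distrib,
    Finset.prod_pow_eq_pow_sum, sum_apply_eq_of_mem_support hP ha, mul_left_comm]

variable {F R σ : Type*} [Field F] [CommRing R] [Fintype σ] {ψ : AddChar F R} {ω : MulChar F R}
  {c : ℕ → R} {n : ℕ}

theorem pow_dvd_prod_sum_pow [Fintype F] {π : R} {m : ℕ} (hπ : π ^ m ∣ Fintype.card F)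
    (E : σ → ℕ) : π ^ (m * Fintype.card {v // E v = 0}) ∣ ∏ v, ∑ y, ω y ^ E v := by
  rw [Fintype.card_subtype, pow_mul, ← Finset.prod_const]
  refine (Finset.prod_dvd_prod_of_dvd _ _ fun v hv => ?_).trans
    (Finset.prod_dvd_prod_of_subset _ _ _ (Finset.filter_subset _ _))
  rw [(Finset.mem_filter.1 hv).2]
  simpa using hπ

variable [DecidableEq σ]

theorem apply_mul_eval_eq_sum (hψ : ∀ x, ψ x = ∑ j ∈ Finset.range n, c j * ω x ^ j)
    (P : MvPolynomial σ F) (s : F) (x : σ → F) :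
    ψ (s * MvPolynomial.eval x P) =
      ∑ J ∈ Fintype.piFinset fun _ : P.support => Finset.range n,
        (∏ a, c (J a) * ω (P.coeff a) ^ J a) *
          (ω s ^ ∑ a, J a) * ∏ v, ω (x v) ^ ∑ a, J a * (a : σ →₀ ℕ) v := by
  rw [MvPolynomial.eval_eq', Finset.mul_sum, addChar_map_sum_eq_prod, ← Finset.prod_coe_sort,
    Finset.prod_congr rfl fun a _ => hψ _, Finset.prod_univ_sum]
  refine Finset.sum_congr rfl fun J _ => ?_
  have hs : ∏ a, ω s ^ J a = ω s ^ ∑ a, J a := Finset.prod_pow_eq_pow_sum _ _ _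
  have hx : ∏ a : P.support, (∏ v, ω (x v) ^ (a : σ →₀ ℕ) v) ^ J a =
      ∏ v, ω (x v) ^ ∑ a, J a * (a : σ →₀ ℕ) v := by
    simp only [← Finset.prod_pow, ← pow_mul, mul_comm (J _), ← Finset.prod_pow_eq_pow_sum]
    exact Finset.prod_comm
  simp only [map_mul, map_prod, map_pow, mul_pow, Finset.prod_mul_distrib, hs, hx]
  ring

variable [Fintype F]

/-- The exponential sum of `t * P(x)` over all points `x`. -/
noncomputable def expSum (ψ : AddChar F R) (P : MvPolynomial σ F) (t : F) : R :=
  ∑ x : σ → F, ψ (t * MvPolynomial.eval x P)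

theorem sum_expSum_pow_eq_sum (hψ : ∀ x, ψ x = ∑ j ∈ Finset.range n, c j * ω x ^ j)
    (P : MvPolynomial σ F) (g : ℕ) :
    ∑ s, expSum ψ P (s ^ g) =
      ∑ J ∈ Fintype.piFinset fun _ : P.support => Finset.range n,
        (∏ a, c (J a) * ω (P.coeff a) ^ J a) *
          (∑ s, ω s ^ (g * ∑ a, J a)) * ∏ v, ∑ y, ω y ^ ∑ a, J a * (a : σ →₀ ℕ) v := by
  have hprod : ∀ E : σ → ℕ, ∏ v, ∑ y, ω y ^ E v = ∑ x : σ → F, ∏ v, ω (x v) ^ E v := fun E => by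
    rw [Finset.prod_univ_sum, Fintype.piFinset_univ]
  simp only [expSum, apply_mul_eval_eq_sum hψ, map_pow, ← pow_mul]
  rw [Finset.sum_congr rfl fun s _ => Finset.sum_comm, Finset.sum_comm]
  refine Finset.sum_congr rfl fun J _ => ?_
  rw [hprod, mul_assoc, Finset.sum_mul_sum]
  simp only [mul_assoc, Finset.mul_sum]

open IsLocalRing

variable [IsLocalRing R] [IsDomain R] {ι : F →+* ResidueField R} {p : ℕ} [hp : Fact p.Prime]
  [Algebra (ZMod p) F] {ζ : R}

-- Only those `J` contribute whose exponents are all divisible by `card F - 1`, and for these the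
-- weight argument bounds the digit sums, hence the power of `ζ - 1` dividing the coefficients.
theorem pow_dvd_sum_expSum_traceChar (hω : IsTeichmullerChar ω ι) (hζ : IsPrimitiveRoot ζ p)
    {f d g : ℕ} (hF : Fintype.card F = p ^ f) (hd : 0 < d) (hg : 0 < g) {P : MvPolynomial σ F}
    (hP : P.IsHomogeneous d) :
    (ζ - 1) ^ (((p - 1) * f * ((g * Fintype.card σ) ⌈/⌉ d)) ⌈/⌉ g) ∣
      ∑ s, expSum (traceChar F hζ.pow_eq_one) P (s ^ g) := by
  obtain ⟨c, hc, hψ⟩ := exists_traceChar_eq_sum hω hζ hF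
  rw [sum_expSum_pow_eq_sum hψ]
  refine Finset.dvd_sum fun J hJ => ?_
  have hJlt : ∀ a, J a < Fintype.card F := fun a =>
    Finset.mem_range.1 (Fintype.mem_piFinset.1 hJ a)
  by_cases hsum : Fintype.card F - 1 ∣ g * ∑ a, J a
  swap
  · rw [sum_pow_eq_zero_of_injective hω.injective hsum, mul_zero, zero_mul]
    exact dvd_zero _
  by_cases hcol : ∀ v, Fintype.card F - 1 ∣ ∑ a, J a * (a : σ →₀ ℕ) v
  swap
  · obtain ⟨v, hv⟩ := not_forall.1 hcol
    rw [Finset.prod_eq_zero (Finset.mem_univ v) (sum_pow_eq_zero_of_injective hω.injective hv),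
      mul_zero]
    exact dvd_zero _
  have hcoeff : (ζ - 1) ^ ∑ a, (p.digits (J a)).sum ∣
      ∏ a : P.support, c (J a) * ω (P.coeff a) ^ J a := by
    rw [← Finset.prod_pow_eq_pow_sum]
    exact Finset.prod_dvd_prod_of_dvd _ _ fun a _ => (hc _ (hJlt a)).mul_right _
  have hcard : (ζ - 1) ^ ((p - 1) * f) ∣ (Fintype.card F : R) := by
    rw [hF, mul_comm]
    exact (associated_sub_one_pow_prime_pow hp.out hζ f).dvd
  rw [hF] at hJlt hsum hcol
  have hweight := mul_ceilDiv_le_mul_sum_digits_add hp.out.one_lt hd hJlt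
    (fun a => sum_apply_eq_of_mem_support hP a.2) hsum hcol
  refine (pow_dvd_pow _ ((ceilDiv_le_iff_le_mul hg).2 hweight)).trans ?_
  rw [pow_add]
  exact mul_dvd_mul (hcoeff.mul_right _) (pow_dvd_prod_sum_pow hcard _)

end ExponentialSums

section PowerSums

theorem sum_comp_eq_card_ker_nsmul {A G M : Type*} [Group A] [Group G] [Fintype A]
    [AddCommMonoid M] (φ : A →* G) [Fintype φ.range] (h : G → M) :
    ∑ a, h (φ a) = Nat.card φ.ker • ∑ t : φ.range, h t := by
  classical
  rw [← Finset.sum_fiberwise _ φ.rangeRestrict, Finset.smul_sum]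
  refine Finset.sum_congr rfl fun t _ => ?_
  have hconst : ∀ a ∈ Finset.univ.filter (φ.rangeRestrict · = t), h (φ a) = h t := fun a ha => by
    rw [← (Finset.mem_filter.1 ha).2, MonoidHom.coe_rangeRestrict]
  have hcard : (Finset.univ.filter (φ.rangeRestrict · = t)).card = Nat.card φ.ker := by
    rw [← φ.ker_rangeRestrict, ← Fintype.card_subtype, ← Nat.card_eq_fintype_card]
    exact Nat.card_congr (φ.rangeRestrict.fiberEquivKerOfSurjective φ.rangeRestrict_surjective t)
  rw [Finset.sum_congr rfl hconst, Finset.sum_const, hcard]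

theorem card_nsmul_sum_subgroup_eq {G M : Type*} [CommGroup G] [Fintype G] [AddCommMonoid M]
    {K : Subgroup G} [Fintype K] {ψ χ : G →* G} (hK : K ⊔ ψ.range = χ.range) {h : G → M}
    (hh : ∀ t v, h (t * ψ v) = h t) :
    Nat.card G • ∑ t : K, h t = Nat.card K • ∑ u, h (χ u) := by
  classical
  set φ : K × G →* G := K.subtype.noncommCoprod ψ fun _ _ => Commute.all _ _ with hφ
  have hrange : φ.range = χ.range := by
    rw [hφ, MonoidHom.noncommCoprod_range, K.range_subtype, hK]
  have hker : Nat.card φ.ker = Nat.card K * Nat.card χ.ker := by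
    refine Nat.eq_of_mul_eq_mul_right (Nat.card_pos (α := χ.range)) ?_
    rw [mul_assoc, ← Subgroup.index_ker, Subgroup.card_mul_index, ← Nat.card_prod,
      Subgroup.index_ker, ← hrange, ← Subgroup.index_ker, Subgroup.card_mul_index]
  calc Nat.card G • ∑ t : K, h t
      = ∑ a, h (φ a) := by
        rw [Fintype.sum_prod_type_right, Nat.card_eq_fintype_card, ← Finset.card_univ,
          ← Finset.sum_const]
        exact Finset.sum_congr rfl fun v _ => Finset.sum_congr rfl fun t _ => (hh t v).symm
    _ = Nat.card φ.ker • ∑ t : φ.range, h t := sum_comp_eq_card_ker_nsmul φ h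
    _ = Nat.card K • Nat.card χ.ker • ∑ t : χ.range, h t := by
        rw [hker, mul_nsmul']
        congr 2
        exact Fintype.sum_equiv (MulEquiv.subgroupCongr hrange).toEquiv _ _ fun _ => rfl
    _ = Nat.card K • ∑ u, h (χ u) := by rw [sum_comp_eq_card_ker_nsmul χ h]

theorem range_powMonoidHom_sup_range_powMonoidHom {G : Type*} [CommGroup G] (a b : ℕ) :
    (powMonoidHom a : G →* G).range ⊔ (powMonoidHom b).range = (powMonoidHom (a.gcd b)).range := by
  refine le_antisymm (sup_le ?_ ?_) ?_
  · rintro _ ⟨u, rfl⟩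
    obtain ⟨c, hc⟩ := a.gcd_dvd_left b
    exact ⟨u ^ c, by rw [powMonoidHom_apply, powMonoidHom_apply, ← pow_mul, mul_comm, ← hc]⟩
  · rintro _ ⟨u, rfl⟩
    obtain ⟨c, hc⟩ := a.gcd_dvd_right b
    exact ⟨u ^ c, by rw [powMonoidHom_apply, powMonoidHom_apply, ← pow_mul, mul_comm, ← hc]⟩
  · rintro _ ⟨u, rfl⟩
    refine Subgroup.mem_sup.2 ⟨_, ⟨u ^ a.gcdA b, rfl⟩, _, ⟨u ^ a.gcdB b, rfl⟩, ?_⟩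
    simp only [powMonoidHom_apply, ← zpow_natCast, ← zpow_mul, ← zpow_add, Nat.gcd_eq_gcd_ab]
    ring_nf

theorem range_powMonoidHom_eq_ker_powMonoidHom {G : Type*} [CommGroup G] [IsCyclic G] [Finite G]
    {M r : ℕ} (hM : M * r = Nat.card G) :
    (powMonoidHom M : G →* G).range = (powMonoidHom r).ker := by
  have hpos : 0 < M * r := hM ▸ Nat.card_pos
  refine Subgroup.eq_of_le_of_card_ge ?_ ?_
  · rintro _ ⟨u, rfl⟩
    rw [MonoidHom.mem_ker, powMonoidHom_apply, powMonoidHom_apply, ← pow_mul, hM, pow_card_eq_one']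
  · rw [IsCyclic.card_powMonoidHom_range, IsCyclic.card_powMonoidHom_ker, ← hM,
      Nat.gcd_mul_left_left, Nat.gcd_mul_right_left,
      Nat.mul_div_cancel_left _ (Nat.pos_of_mul_pos_right hpos)]

theorem nsmul_sum_ker_powMonoidHom_eq {G A : Type*} [CommGroup G] [IsCyclic G] [Fintype G]
    [AddCommMonoid A] [IsAddTorsionFree A] {d M r : ℕ} [Fintype (powMonoidHom r : G →* G).ker]
    (hM : M * r = Nat.card G) {h : G → A} (hh : ∀ t v, h (t * v ^ d) = h t) :
    M • ∑ t : (powMonoidHom r : G →* G).ker, h t = ∑ u, h (u ^ d.gcd M) := by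
  have hker : Nat.card (powMonoidHom r : G →* G).ker = r := by
    rw [IsCyclic.card_powMonoidHom_ker, ← hM, Nat.gcd_mul_left_left]
  have hr : r ≠ 0 := by
    rintro rfl
    exact Nat.card_pos.ne hM
  refine nsmul_right_injective hr ?_
  have hsup : (powMonoidHom r : G →* G).ker ⊔ (powMonoidHom d).range =
      (powMonoidHom (d.gcd M)).range := by
    rw [← range_powMonoidHom_eq_ker_powMonoidHom hM, sup_comm,
      range_powMonoidHom_sup_range_powMonoidHom]
  have hsum := card_nsmul_sum_subgroup_eq hsup hh
  rwa [hker, ← hM, mul_nsmul] at hsum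

end PowerSums

section PointCount

/-- The number of `F`-rational zeros of `P` in affine space. -/
noncomputable def numZeros {F σ : Type*} [Field F] (P : MvPolynomial σ F) : ℕ :=
  Nat.card {x // MvPolynomial.eval x P = 0}

theorem sum_filter_pow_eq_self {F A : Type*} [Field F] [Fintype F] [DecidableEq F]
    [AddCommMonoid A] {q : ℕ} [Fintype (powMonoidHom (q - 1) : Fˣ →* Fˣ).ker] (hq : 1 < q)
    (h : F → A) :
    ∑ t with t ^ q = t, h t = h 0 + ∑ u : (powMonoidHom (q - 1) : Fˣ →* Fˣ).ker, h (u : Fˣ) := by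
  have hmem : ∀ u : Fˣ, (u : F) ^ q = u ↔ u ∈ (powMonoidHom (q - 1) : Fˣ →* Fˣ).ker := fun u => by
    rw [MonoidHom.mem_ker, powMonoidHom_apply, ← Nat.sub_add_cancel hq.le, Nat.add_sub_cancel,
      pow_succ, mul_eq_right₀ u.ne_zero, Units.ext_iff, Units.val_pow_eq_pow_val, Units.val_one]
  rw [Finset.sum_filter, sum_eq_apply_zero_add_sum_units, if_pos (zero_pow (by lia)),
    ← Finset.sum_filter]
  exact congrArg _ (Finset.sum_subtype _ (fun u => (Finset.mem_filter_univ u).trans (hmem u)) _)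

theorem pow_injective_of_isPrimitive {F R : Type*} [Field F] [Finite F] [CommRing R]
    {ψ : AddChar F R} {q : ℕ} (hψ : ψ.IsPrimitive) (hψq : ∀ x, ψ (x ^ q) = ψ x) :
    Function.Injective fun y : F => y ^ q := fun y z (hyz : y ^ q = z ^ q) => by
  refine AddChar.to_mulShift_inj_of_isPrimitive hψ (DFunLike.ext _ _ fun s => ?_)
  rw [AddChar.mulShift_apply, AddChar.mulShift_apply, ← hψq, mul_pow, hyz, ← mul_pow, hψq]

variable {F R : Type*} [Field F] [Fintype F] [CommRing R] {ψ : AddChar F R} {d q : ℕ}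

theorem expSum_zero {σ : Type*} [Fintype σ] [DecidableEq σ] (ψ : AddChar F R)
    (P : MvPolynomial σ F) : expSum ψ P 0 = (Fintype.card F : R) ^ Fintype.card σ := by
  simp [expSum]

theorem expSum_mul_pow {σ : Type*} [Fintype σ] [DecidableEq σ] (ψ : AddChar F R)
    {P : MvPolynomial σ F} (hP : P.IsHomogeneous d) (t : F) (v : Fˣ) :
    expSum ψ P (t * v ^ d) = expSum ψ P t := by
  refine Fintype.sum_equiv (MulAction.toPerm v) _ _ fun x => ?_
  rw [MulAction.toPerm_apply, Units.smul_def, eval_smul_of_isHomogeneous hP, mul_assoc]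

variable [IsDomain R]

theorem sum_apply_mul_sub_pow [DecidableEq F] (hψ : ψ.IsPrimitive) (hψq : ∀ x, ψ (x ^ q) = ψ x)
    (t : F) : ∑ y, ψ (t * (y - y ^ q)) = if t ^ q = t then (Fintype.card F : R) else 0 := by
  have hbij := Finite.injective_iff_bijective.1 (pow_injective_of_isPrimitive hψ hψq)
  calc ∑ y, ψ (t * (y - y ^ q))
      = ∑ y, ψ (y ^ q * (t ^ q - t)) := Finset.sum_congr rfl fun y _ => by
        rw [mul_sub, sub_eq_add_neg, ψ.map_add_eq_mul, ← hψq (t * y), ← ψ.map_add_eq_mul]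
        ring_nf
    _ = ∑ y, ψ (y * (t ^ q - t)) := hbij.sum_comp fun y => ψ (y * (t ^ q - t))
    _ = if t ^ q = t then (Fintype.card F : R) else 0 := by
        rw [AddChar.sum_mulShift _ hψ]
        simp only [sub_eq_zero, Nat.cast_ite, Nat.cast_zero]

theorem card_mul_numZeros_eq_sum_expSum {σ : Type*} [Fintype σ] [DecidableEq σ] (hψ : ψ.IsPrimitive)
    (P : MvPolynomial σ F) :
    (Fintype.card F : R) * numZeros P = ∑ t, expSum ψ P t := by
  classical
  simp only [expSum]
  rw [Finset.sum_comm, numZeros, Nat.card_eq_fintype_card, Fintype.card_subtype,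
    Finset.card_filter, Nat.cast_sum, Finset.mul_sum]
  refine Finset.sum_congr rfl fun x _ => ?_
  rw [AddChar.sum_mulShift _ hψ]
  simp

variable [CharZero R] {k : ℕ}

theorem artinSchreierCount_eq_sum_expSum [DecidableEq F] (hψ : ψ.IsPrimitive)
    (hψq : ∀ x, ψ (x ^ q) = ψ x) (P : MvPolynomial (Fin k) F) :
    (artinSchreierCount q P : R) = ∑ t with t ^ q = t, expSum ψ P t := by
  have hN : (artinSchreierCount q P : R) = ∑ x : Fin k → F, ∑ y : F,
      if MvPolynomial.eval x P - (y ^ q - y) = 0 then 1 else 0 := by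
    rw [artinSchreierCount, Nat.card_eq_fintype_card, Fintype.card_subtype, Finset.card_filter,
      Fintype.sum_prod_type]
    simp [sub_eq_zero]
  have hindicator : ∀ b : F, (Fintype.card F : R) * (if b = 0 then 1 else 0) = ∑ t, ψ (t * b) :=
    fun b => by rw [AddChar.sum_mulShift _ hψ]; simp
  refine mul_left_cancel₀ (Nat.cast_ne_zero.2 Fintype.card_ne_zero : (Fintype.card F : R) ≠ 0) ?_
  calc (Fintype.card F : R) * artinSchreierCount q P
      = ∑ x : Fin k → F, ∑ y, ∑ t, ψ (t * (MvPolynomial.eval x P - (y ^ q - y))) := by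
        simp only [hN, Finset.mul_sum, hindicator]
    _ = ∑ x : Fin k → F, ∑ t, ∑ y, ψ (t * MvPolynomial.eval x P) * ψ (t * (y - y ^ q)) := by
        refine Finset.sum_congr rfl fun x _ => Finset.sum_comm.trans ?_
        simp only [← ψ.map_add_eq_mul, ← mul_add, sub_sub_eq_add_sub, add_sub_assoc]
    _ = ∑ t, expSum ψ P t * ∑ y, ψ (t * (y - y ^ q)) := by
        simp only [expSum, Finset.sum_mul_sum]
        exact Finset.sum_comm
    _ = (Fintype.card F : R) * ∑ t with t ^ q = t, expSum ψ P t := by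
        simp only [sum_apply_mul_sub_pow hψ hψq, mul_ite, mul_zero, ← Finset.sum_filter]
        rw [← Finset.sum_mul, mul_comm]

theorem mul_artinSchreierCount_add (hψ : ψ.IsPrimitive) (hψq : ∀ x, ψ (x ^ q) = ψ x) (hd : 0 < d)
    {M : ℕ} (hM : M * (q - 1) = Fintype.card F - 1) {P : MvPolynomial (Fin k) F}
    (hP : P.IsHomogeneous d) :
    (M : R) * artinSchreierCount q P + (Fintype.card F : R) ^ k =
      M * (Fintype.card F : R) ^ k + ∑ s, expSum ψ P (s ^ d.gcd M) := by
  classical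
  have hcard : M * (q - 1) = Nat.card Fˣ := by
    rw [hM, Nat.card_eq_fintype_card, Fintype.card_units]
  have hq : 1 < q := Nat.lt_of_sub_pos (Nat.pos_of_mul_pos_left (hcard ▸ Nat.card_pos))
  have hpow := nsmul_sum_ker_powMonoidHom_eq hcard (h := fun t : Fˣ => expSum ψ P t) fun t v => by
    rw [Units.val_mul, Units.val_pow_eq_pow_val, expSum_mul_pow ψ hP]
  simp only [Units.val_pow_eq_pow_val, nsmul_eq_mul] at hpow
  rw [artinSchreierCount_eq_sum_expSum hψ hψq, sum_filter_pow_eq_self hq (expSum ψ P),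
    mul_add, hpow, sum_eq_apply_zero_add_sum_units fun s => expSum ψ P (s ^ d.gcd M),
    zero_pow (Nat.gcd_pos_of_pos_left _ hd).ne', expSum_zero, Fintype.card_fin]
  ring

end PointCount

section Divisibility

open IsLocalRing

theorem padicValNat_eq_of_mul_eq_pow_mul {p M N n u : ℕ} [hp : Fact p.Prime] (hM : ¬p ∣ M)
    (hu : ¬p ∣ u) (h : M * N = p ^ n * u) : padicValNat p N = n := by
  have hne : p ^ n * u ≠ 0 :=
    mul_ne_zero (pow_ne_zero n hp.out.ne_zero) fun hu0 => hu (hu0 ▸ dvd_zero p)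
  have hval := congrArg (padicValNat p) h
  rwa [padicValNat.mul (left_ne_zero_of_mul (h ▸ hne)) (right_ne_zero_of_mul (h ▸ hne)),
    padicValNat.mul (left_ne_zero_of_mul hne) (right_ne_zero_of_mul hne), padicValNat.prime_pow,
    padicValNat.eq_zero_of_not_dvd hM, padicValNat.eq_zero_of_not_dvd hu, zero_add,
    add_zero] at hval

theorem le_mul_padicValNat_of_pow_dvd {R : Type*} [CommRing R] [IsDomain R] [IsLocalRing R]
    {p n z : ℕ} [hp : Fact p.Prime] [CharP (ResidueField R) p] {ζ : R} (hζ : IsPrimitiveRoot ζ p)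
    (hz : z ≠ 0) (h : (ζ - 1) ^ n ∣ (z : R)) : n ≤ (p - 1) * padicValNat p z := by
  obtain ⟨a, u, hpu, rfl⟩ := Nat.exists_eq_pow_mul_and_not_dvd hz p hp.out.ne_one
  have hunit : IsUnit (u : R) := by
    rwa [← residue_ne_zero_iff_isUnit, map_natCast, Ne, CharP.cast_eq_zero_iff _ p]
  have hne : ζ - 1 ≠ 0 := sub_ne_zero.2 (hζ.ne_one hp.out.one_lt)
  have hnonunit : ¬IsUnit (ζ - 1) := fun hunit => by
    refine (residue_ne_zero_iff_isUnit _).2 hunit ?_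
    rw [map_sub, residue_eq_one_of_pow_char_eq_one hζ.pow_eq_one, map_one, sub_self]
  have hval : padicValNat p (p ^ a * u) = a :=
    padicValNat_eq_of_mul_eq_pow_mul hp.out.not_dvd_one hpu (one_mul _)
  rw [Nat.cast_mul, hunit.dvd_mul_right] at h
  rw [hval, mul_comm]
  exact (pow_dvd_pow_iff hne hnonunit).1
    (h.trans (associated_sub_one_pow_prime_pow hp.out hζ a).symm.dvd)

theorem artinSchreierCount_ne_zero {F : Type*} [Field F] [Finite F] {k q d : ℕ} (hq : q ≠ 0)
    (hd : d ≠ 0) {P : MvPolynomial (Fin k) F} (hP : P.IsHomogeneous d) :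
    artinSchreierCount q P ≠ 0 := by
  have hzero := eval_smul_of_isHomogeneous hP 0 0
  rw [zero_pow hd, zero_mul, zero_smul] at hzero
  have : Nonempty {v : (Fin k → F) × F // MvPolynomial.eval v.1 P = v.2 ^ q - v.2} :=
    ⟨⟨(0, 0), by rw [hzero, zero_pow hq, sub_zero]⟩⟩
  exact Nat.card_pos.ne'

theorem not_dvd_of_mul_eq_sub_one {p M r Q : ℕ} (hp : p.Prime) (hpQ : p ∣ Q) (hQ : Q ≠ 0)
    (h : M * r = Q - 1) : ¬p ∣ M := fun hM => by
  have hsub : p ∣ Q - (Q - 1) := Nat.dvd_sub hpQ (h ▸ hM.mul_right r)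
  rw [Nat.sub_sub_self (Nat.one_le_iff_ne_zero.2 hQ)] at hsub
  exact hp.one_lt.ne' (Nat.dvd_one.1 hsub)

variable {F : Type*} [Field F] [Fintype F] {p e f k d M : ℕ}

theorem pow_dvd_mul_artinSchreierCount {R : Type*} [CommRing R] [IsDomain R] [CharZero R]
    [IsLocalRing R] {ι : F →+* ResidueField R} {ω : MulChar F R} {ζ : R} [hp : Fact p.Prime]
    [Algebra (ZMod p) F] (hω : IsTeichmullerChar ω ι) (hζ : IsPrimitiveRoot ζ p)
    (hF : Fintype.card F = p ^ f) (hd : 0 < d) (hM : M * (p ^ e - 1) = Fintype.card F - 1)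
    {P : MvPolynomial (Fin k) F} (hP : P.IsHomogeneous d) :
    (ζ - 1) ^ (((p - 1) * f * ((d.gcd M * k) ⌈/⌉ d)) ⌈/⌉ d.gcd M) ∣
      ((M * artinSchreierCount (p ^ e) P : ℕ) : R) := by
  have hg : 0 < d.gcd M := Nat.gcd_pos_of_pos_left _ hd
  have hsum := pow_dvd_sum_expSum_traceChar hω hζ hF hd hg hP
  have hcount := mul_artinSchreierCount_add (traceChar_isPrimitive (F := F) hζ)
    (traceChar_pow_char_pow hζ.pow_eq_one e) hd hM hP
  rw [Fintype.card_fin] at hsum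
  set n := ((p - 1) * f * ((d.gcd M * k) ⌈/⌉ d)) ⌈/⌉ d.gcd M
  have hpow : (ζ - 1) ^ n ∣ (Fintype.card F : R) ^ k := by
    have hn : n ≤ f * (p - 1) * k := (ceilDiv_le_iff_le_mul hg).2 <|
      calc (p - 1) * f * ((d.gcd M * k) ⌈/⌉ d)
          ≤ (p - 1) * f * (d.gcd M * k) :=
            Nat.mul_le_mul_left _ ((ceilDiv_le_iff_le_mul hd).2 (Nat.le_mul_of_pos_left _ hd))
        _ = d.gcd M * (f * (p - 1) * k) := by ring
    rw [hF]
    exact (pow_dvd_pow _ hn).trans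
      (pow_mul (ζ - 1) _ k ▸ (associated_sub_one_pow_prime_pow hp.out hζ f).pow_pow.dvd)
  rw [Nat.cast_mul]
  exact (dvd_add_left hpow).1 (hcount ▸ dvd_add (hpow.mul_left _) hsum)

theorem mul_ceilDiv_le_mul_padicValNat (hp : p.Prime) (hF : Fintype.card F = p ^ f) (hd : 0 < d)
    (hM : M * (p ^ e - 1) = Fintype.card F - 1) {P : MvPolynomial (Fin k) F}
    (hP : P.IsHomogeneous d) :
    f * ((d.gcd M * k) ⌈/⌉ d) ≤ d.gcd M * padicValNat p (artinSchreierCount (p ^ e) P) := by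
  have : Fact p.Prime := ⟨hp⟩
  have : CharP F p := charP_of_card_eq_prime_pow hF
  let := ZMod.algebra F p
  obtain ⟨A, ι, ω, ζ, hω, hζ⟩ := exists_valuationSubring_isTeichmullerChar F p
  have : CharP (ResidueField A) p := charP_of_injective_ringHom ι.injective p
  have hpM : ¬p ∣ M := not_dvd_of_mul_eq_sub_one hp
    ((CharP.cast_eq_zero_iff F p _).1 (FiniteField.cast_card_eq_zero F)) Fintype.card_ne_zero hM
  have hM0 : M ≠ 0 := fun h => hpM (h ▸ dvd_zero p)
  have hN0 := artinSchreierCount_ne_zero (pow_ne_zero e hp.ne_zero) hd.ne' hP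
  have hle := le_mul_padicValNat_of_pow_dvd hζ (mul_ne_zero hM0 hN0)
    (pow_dvd_mul_artinSchreierCount hω hζ hF hd hM hP)
  rw [padicValNat.mul hM0 hN0, padicValNat.eq_zero_of_not_dvd hpM, zero_add,
    ceilDiv_le_iff_le_mul (Nat.gcd_pos_of_pos_left _ hd)] at hle
  refine Nat.le_of_mul_le_mul_left ?_ (Nat.sub_pos_of_lt hp.one_lt)
  rwa [← mul_assoc, mul_left_comm]

end Divisibility

section Sharpness

open MvPolynomial

theorem mul_artinSchreierCount_add_of_coprime {F : Type*} [Field F] [Fintype F]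
    {p e k d M : ℕ} (hp : p.Prime) [CharP F p] (hd : 0 < d) (hdM : d.Coprime M)
    (hM : M * (p ^ e - 1) = Fintype.card F - 1) {P : MvPolynomial (Fin k) F}
    (hP : P.IsHomogeneous d) :
    M * artinSchreierCount (p ^ e) P + Fintype.card F ^ k =
      M * Fintype.card F ^ k + Fintype.card F * numZeros P := by
  have : Fact p.Prime := ⟨hp⟩
  let := ZMod.algebra F p
  have hζ := Complex.isPrimitiveRoot_exp p hp.ne_zero
  have hψ := traceChar_isPrimitive (F := F) hζ
  have hcount := mul_artinSchreierCount_add hψ (traceChar_pow_char_pow hζ.pow_eq_one e) hd hM hP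
  simp only [hdM.gcd_eq_one, pow_one, ← card_mul_numZeros_eq_sum_expSum hψ] at hcount
  exact_mod_cast hcount

theorem prod_X_isHomogeneous {R σ ι : Type*} [CommSemiring R] [Fintype ι] (i : ι → σ) :
    (∏ j, X (i j) : MvPolynomial σ R).IsHomogeneous (Fintype.card ι) := by
  have h := IsHomogeneous.prod Finset.univ (fun j => (X (i j) : MvPolynomial σ R)) (fun _ => 1)
    fun j _ => isHomogeneous_X R (i j)
  rwa [Finset.sum_const, smul_eq_mul, mul_one] at h

variable {F : Type*} [Field F]

theorem numZeros_eq_sum {σ : Type*} [Fintype (σ → F)] [DecidableEq F] (P : MvPolynomial σ F) :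
    numZeros P = ∑ x : σ → F, if eval x P = 0 then 1 else 0 := by
  rw [numZeros, Nat.card_eq_fintype_card, Fintype.card_subtype, Finset.card_filter]

theorem numZeros_X_pow_mul_prod_X {σ : Type*} [Fintype σ] (i : σ) (n : ℕ) :
    numZeros (X i ^ n * ∏ j, X j : MvPolynomial σ F) =
      numZeros (∏ j, X j : MvPolynomial σ F) := by
  have hzeros : ∀ x : σ → F, eval x (X i ^ n * ∏ j, X j) = 0 ↔ eval x (∏ j, X j) = 0 := fun x => by
    simp only [map_mul, map_pow, eval_X, map_prod, mul_eq_zero, or_iff_right_iff_imp]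
    exact fun h => Finset.prod_eq_zero (Finset.mem_univ i) (eq_zero_of_pow_eq_zero h)
  simp only [numZeros, hzeros]

section

variable [Fintype F] {σ : Type*} [Fintype σ]

theorem numZeros_zero : numZeros (0 : MvPolynomial σ F) = Fintype.card F ^ Fintype.card σ := by
  classical
  simp [numZeros, Nat.card_eq_fintype_card]

theorem card_filter_prod_ne_zero [DecidableEq F] [DecidableEq σ] :
    ({y | ∏ i, y i ≠ 0} : Finset (σ → F)).card = (Fintype.card F - 1) ^ Fintype.card σ := by
  have : ({y | ∏ i, y i ≠ 0} : Finset (σ → F)) =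
      Fintype.piFinset fun _ => Finset.univ.erase 0 := by
    ext y
    simp [Finset.prod_eq_zero_iff]
  rw [this, Fintype.card_piFinset]
  simp

theorem sum_ite_prod_eq_zero [DecidableEq F] [DecidableEq σ] (a b : ℕ) :
    ∑ y : σ → F, (if ∏ i, y i = 0 then a else b) =
      numZeros (∏ i, X i : MvPolynomial σ F) * a +
        (Fintype.card F - 1) ^ Fintype.card σ * b := by
  rw [Finset.sum_ite, Finset.sum_const, Finset.sum_const, ← card_filter_prod_ne_zero,
    numZeros, Nat.card_eq_fintype_card, Fintype.card_subtype]
  simp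

theorem numZeros_prod_X_add :
    numZeros (∏ i, X i : MvPolynomial σ F) + (Fintype.card F - 1) ^ Fintype.card σ =
      Fintype.card F ^ Fintype.card σ := by
  classical
  simpa using (sum_ite_prod_eq_zero (F := F) (σ := σ) 1 1).symm

end

/-- The polynomial `X₀ ⋯ Xₙ₋₁ + P(Xₙ, …, Xₙ₊ⱼ₋₁)`, the building block of the polynomials for which
the lower bound is attained. -/
noncomputable def prodXAdd {j : ℕ} (n : ℕ) (P : MvPolynomial (Fin j) F) :
    MvPolynomial (Fin (n + j)) F :=
  ∏ i, X (Fin.castAdd j i) + rename (Fin.natAdd n) P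

theorem prodXAdd_isHomogeneous {j n : ℕ} {P : MvPolynomial (Fin j) F} (hP : P.IsHomogeneous n) :
    (prodXAdd n P).IsHomogeneous n := by
  have h := prod_X_isHomogeneous (R := F) (Fin.castAdd j : Fin n → Fin (n + j))
  rw [Fintype.card_fin] at h
  exact h.add hP.rename_isHomogeneous

theorem eval_append_prodXAdd {j n : ℕ} (P : MvPolynomial (Fin j) F) (a : Fin n → F)
    (b : Fin j → F) : eval (Fin.append a b) (prodXAdd n P) = ∏ i, a i + eval b P := by
  simp [prodXAdd, eval_rename, Function.comp_def]

theorem sum_ite_mul_add_eq_zero [Fintype F] [DecidableEq F] (a b : F) :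
    ∑ z : F, (if z * a + b = 0 then 1 else 0) =
      if a = 0 then Fintype.card F * (if b = 0 then 1 else 0) else 1 := by
  rcases eq_or_ne a 0 with rfl | ha
  · simp
  · have hroot : ∀ z, z * a + b = 0 ↔ z = -b / a := fun z => by
      rw [eq_div_iff ha, ← add_eq_zero_iff_eq_neg]
    simp [ha, hroot]

theorem numZeros_prodXAdd_succ [Fintype F] {j : ℕ} (n : ℕ) (P : MvPolynomial (Fin j) F) :
    numZeros (prodXAdd (n + 1) P) =
      numZeros (∏ i, X i : MvPolynomial (Fin n) F) * (Fintype.card F * numZeros P) +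
        (Fintype.card F - 1) ^ n * Fintype.card F ^ j := by
  classical
  calc numZeros (prodXAdd (n + 1) P)
      = ∑ b : Fin j → F, ∑ a : Fin (n + 1) → F, if ∏ i, a i + eval b P = 0 then 1 else 0 := by
        rw [numZeros_eq_sum, ← (Fin.appendEquiv (n + 1) j).sum_comp, Fintype.sum_prod_type_right]
        simp only [Fin.appendEquiv, Equiv.coe_fn_mk, eval_append_prodXAdd]
    _ = ∑ b : Fin j → F, ∑ y : Fin n → F,
          if ∏ i, y i = 0 then Fintype.card F * (if eval b P = 0 then 1 else 0) else 1 := by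
        refine Finset.sum_congr rfl fun b _ => ?_
        rw [← (Fin.consEquiv fun _ => F).sum_comp, Fintype.sum_prod_type_right]
        simp only [Fin.consEquiv_apply, Fin.prod_univ_succ, Fin.cons_zero, Fin.cons_succ,
          sum_ite_mul_add_eq_zero]
    _ = _ := by
        simp only [sum_ite_prod_eq_zero, Finset.sum_add_distrib, ← Finset.mul_sum,
          ← numZeros_eq_sum]
        simp only [Fintype.card_fin, Finset.sum_const, Finset.card_univ, Fintype.card_fun,
          smul_eq_mul, mul_one, mul_comm]

variable [Fintype F] {p : ℕ}

theorem not_dvd_card_sub_one_pow (hp : p.Prime) (hpF : p ∣ Fintype.card F) (n : ℕ) :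
    ¬p ∣ (Fintype.card F - 1) ^ n := fun h =>
  not_dvd_of_mul_eq_sub_one hp hpF Fintype.card_ne_zero (mul_one _) (hp.dvd_of_dvd_pow h)

theorem not_dvd_numZeros_prod_X (hp : p.Prime) (hpF : p ∣ Fintype.card F) {n : ℕ} (hn : n ≠ 0) :
    ¬p ∣ numZeros (∏ i, X i : MvPolynomial (Fin n) F) := fun h =>
  not_dvd_card_sub_one_pow hp hpF n <| (Nat.dvd_add_right h).1 <| by
    have hsum := numZeros_prod_X_add (F := F) (σ := Fin n)
    rw [Fintype.card_fin] at hsum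
    exact hsum ▸ hpF.trans (dvd_pow_self _ hn)

theorem exists_isHomogeneous_not_dvd_numZeros (hp : p.Prime) (hpF : p ∣ Fintype.card F) {d k : ℕ}
    (hk : k ≠ 0) (hkd : k ≤ d) :
    ∃ P : MvPolynomial (Fin k) F, P.IsHomogeneous d ∧ ¬p ∣ numZeros P := by
  obtain ⟨j, rfl⟩ := Nat.exists_eq_succ_of_ne_zero hk
  refine ⟨X 0 ^ (d - (j + 1)) * ∏ i, X i, ?_, ?_⟩
  · have h := (isHomogeneous_X_pow (R := F) (0 : Fin (j + 1)) (d - (j + 1))).mul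
      (prod_X_isHomogeneous id)
    rwa [Fintype.card_fin, Nat.sub_add_cancel hkd] at h
  · rw [numZeros_X_pow_mul_prod_X]
    exact not_dvd_numZeros_prod_X hp hpF hk

theorem numZeros_prodXAdd_zero (n c : ℕ) :
    numZeros (prodXAdd (n + 1) (0 : MvPolynomial (Fin (c + 1)) F)) = Fintype.card F ^ (c + 1) *
      (numZeros (∏ i, X i : MvPolynomial (Fin n) F) * Fintype.card F +
        (Fintype.card F - 1) ^ n) := by
  rw [numZeros_prodXAdd_succ, numZeros_zero, Fintype.card_fin]
  ring

theorem numZeros_prodXAdd_of_eq_pow_mul {n j c w : ℕ} {P : MvPolynomial (Fin j) F}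
    (hcj : c + 1 ≤ j) (hP : numZeros P = Fintype.card F ^ c * w) :
    numZeros (prodXAdd (n + 1) P) = Fintype.card F ^ (c + 1) *
      (numZeros (∏ i, X i : MvPolynomial (Fin n) F) * w +
        (Fintype.card F - 1) ^ n * Fintype.card F ^ (j - (c + 1))) := by
  obtain ⟨i, rfl⟩ := Nat.exists_eq_add_of_le hcj
  rw [numZeros_prodXAdd_succ, hP, Nat.add_sub_cancel_left]
  ring

theorem exists_isHomogeneous_numZeros_eq_pow_mul (hp : p.Prime) (hpF : p ∣ Fintype.card F)
    {d c k : ℕ} (hck : d * c < k) (hkc : k ≤ d * (c + 1)) :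
    ∃ P : MvPolynomial (Fin k) F, P.IsHomogeneous d ∧
      ∃ u, ¬p ∣ u ∧ numZeros P = Fintype.card F ^ c * u := by
  induction c generalizing k with
  | zero =>
    obtain ⟨P, hP, hpP⟩ := exists_isHomogeneous_not_dvd_numZeros hp hpF
      (Nat.ne_of_gt (Nat.zero_lt_of_lt hck)) (by simpa using hkc)
    exact ⟨P, hP, numZeros P, hpP, by rw [pow_zero, one_mul]⟩
  | succ c ih =>
    obtain ⟨n, rfl⟩ : ∃ n, d = n + 1 := Nat.exists_eq_succ_of_ne_zero (by rintro rfl; lia)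
    obtain ⟨j, rfl⟩ : ∃ j, k = n + 1 + j := Nat.exists_eq_add_of_le (by nlinarith)
    have hcj : (n + 1) * c < j := by linarith
    have hcj' : c + 1 ≤ j := by nlinarith
    rcases hcj'.eq_or_lt with rfl | hlt
    · exact ⟨prodXAdd (n + 1) 0, prodXAdd_isHomogeneous (isHomogeneous_zero _ _ _), _,
        fun h => not_dvd_card_sub_one_pow hp hpF n ((Nat.dvd_add_right (hpF.mul_left _)).1 h),
        numZeros_prodXAdd_zero n c⟩
    · obtain ⟨P, hP, w, hpw, hw⟩ := ih hcj (by linarith)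
      have hn : n ≠ 0 := by rintro rfl; lia
      refine ⟨prodXAdd (n + 1) P, prodXAdd_isHomogeneous hP, _, fun h => ?_,
        numZeros_prodXAdd_of_eq_pow_mul hcj' hw⟩
      have hpow : p ∣ (Fintype.card F - 1) ^ n * Fintype.card F ^ (j - (c + 1)) :=
        (hpF.trans (dvd_pow_self _ (Nat.sub_ne_zero_of_lt hlt))).mul_left _
      exact hp.not_dvd_mul (not_dvd_numZeros_prod_X hp hpF hn) hpw
        ((Nat.dvd_add_left hpow).1 h)

theorem dvd_sub_one_of_mul_eq_sub_one {p q Q M : ℕ} (hpq : p ∣ q) (hpQ : p ∣ Q) (hq : q ≠ 0)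
    (hQ : Q ≠ 0) (hM : M * (q - 1) = Q - 1) : p ∣ M - 1 := by
  rcases Nat.eq_zero_or_pos M with rfl | hM0
  · exact dvd_zero p
  have hsum : M - 1 + Q = M * q := by
    obtain ⟨r, rfl⟩ := Nat.exists_eq_succ_of_ne_zero hq
    rw [Nat.succ_sub_one] at hM
    rw [Nat.mul_succ]
    lia
  exact (Nat.dvd_add_left hpQ).1 (hsum ▸ hpq.mul_left M)

theorem padicValNat_eq_of_mul_add_eq {p f M N k c u : ℕ} (hp : p.Prime)
    (hpM : ¬p ∣ M) (hpM' : p ∣ M - 1) (hck : c < k) (hu : ¬p ∣ u)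
    (h : M * N + (p ^ f) ^ k = M * (p ^ f) ^ k + p ^ f * ((p ^ f) ^ c * u)) :
    padicValNat p N = f * (c + 1) := by
  have : Fact p.Prime := ⟨hp⟩
  obtain ⟨L, rfl⟩ : ∃ L, M = L + 1 :=
    Nat.exists_eq_succ_of_ne_zero fun hM => hpM (hM ▸ dvd_zero p)
  obtain ⟨j, rfl⟩ : ∃ j, k = c + 1 + j := Nat.exists_eq_add_of_le hck
  have hMN : (L + 1) * N = p ^ (f * (c + 1)) * (L * (p ^ f) ^ j + u) := by
    refine Nat.add_right_cancel (m := (p ^ f) ^ (c + 1 + j)) ?_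
    rw [h, pow_mul]
    ring
  exact padicValNat_eq_of_mul_eq_pow_mul hpM
    (fun hdvd => hu ((Nat.dvd_add_right (hpM'.mul_right _)).1 hdvd)) hMN

theorem ceilDiv_eq_succ {k d c : ℕ} (hck : d * c < k) (hkc : k ≤ d * (c + 1)) :
    k ⌈/⌉ d = c + 1 := by
  have hd : 0 < d := Nat.pos_of_mul_pos_right ((Nat.zero_lt_of_lt hck).trans_le hkc)
  refine le_antisymm ((ceilDiv_le_iff_le_mul hd).2 hkc) (Nat.succ_le_of_lt ?_)
  exact lt_of_not_ge fun h => hck.not_ge ((ceilDiv_le_iff_le_mul hd).1 h)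

theorem exists_padicValNat_artinSchreierCount_eq {e f k d M : ℕ} (hp : p.Prime)
    (hF : Fintype.card F = p ^ f) (hk : 0 < k) (hd : 0 < d) (hdM : d.Coprime M)
    (hM : M * (p ^ e - 1) = Fintype.card F - 1) :
    ∃ P : MvPolynomial (Fin k) F, P ≠ 0 ∧ P.IsHomogeneous d ∧
      padicValNat p (artinSchreierCount (p ^ e) P) = f * (k ⌈/⌉ d) := by
  have : Fact p.Prime := ⟨hp⟩
  have : CharP F p := charP_of_card_eq_prime_pow hF
  have hpF : p ∣ Fintype.card F :=
    (CharP.cast_eq_zero_iff F p _).1 (FiniteField.cast_card_eq_zero F)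
  have he : e ≠ 0 := by
    rintro rfl
    exact (Nat.sub_pos_of_lt (Fintype.one_lt_card (α := F))).ne hM
  have hpM := not_dvd_of_mul_eq_sub_one hp hpF Fintype.card_ne_zero hM
  have hpM' := dvd_sub_one_of_mul_eq_sub_one (dvd_pow_self p he) hpF (pow_ne_zero e hp.ne_zero)
    Fintype.card_ne_zero hM
  obtain ⟨c, hck, hkc⟩ : ∃ c, d * c < k ∧ k ≤ d * (c + 1) :=
    ⟨(k - 1) / d, (Nat.mul_div_le _ d).trans_lt (Nat.sub_one_lt_of_lt hk),
      Nat.le_of_pred_lt (Nat.lt_mul_div_succ (k - 1) hd)⟩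
  have hc : c < k := (Nat.le_mul_of_pos_left c hd).trans_lt hck
  obtain ⟨P, hP, u, hpu, hu⟩ := exists_isHomogeneous_numZeros_eq_pow_mul hp hpF hck hkc
  refine ⟨P, ?_, hP, ?_⟩
  · rintro rfl
    rw [numZeros_zero, Fintype.card_fin, ← Nat.add_sub_of_le hc.le, pow_add] at hu
    exact hpu (Nat.eq_of_mul_eq_mul_left (pow_pos Fintype.card_pos c) hu ▸
      hpF.trans (dvd_pow_self _ (Nat.sub_ne_zero_of_lt hc)))
  · have hcount := mul_artinSchreierCount_add_of_coprime hp hd hdM hM hP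
    rw [hu, hF] at hcount
    rw [ceilDiv_eq_succ hck hkc]
    exact padicValNat_eq_of_mul_add_eq hp hpM hpM' hc hpu hcount

end Sharpness

theorem natCeil_div_eq_ceilDiv {d : ℕ} (hd : 0 < d) (a : ℕ) : ⌈(a : ℚ) / d⌉₊ = a ⌈/⌉ d := by
  refine eq_of_forall_ge_iff fun b => ?_
  rw [Nat.ceil_le, div_le_iff₀' (Nat.cast_pos.2 hd), ceilDiv_le_iff_le_mul hd]
  exact_mod_cast Iff.rfl

theorem mainTheorem2 {F : Type*} [Field F] [Finite F] (p e q m k d g : ℕ)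
    (hp : p.Prime) (he : 1 ≤ e) (hq : q = p ^ e) (hm : 1 ≤ m) (hF : Nat.card F = q ^ m)
    (hk : 1 ≤ k) (hd : 1 ≤ d) (hg : g = Nat.gcd d ((q ^ m - 1) / (q - 1))) :
    (∀ f : MvPolynomial (Fin k) F, f.IsHomogeneous d →
      ⌈((e : ℚ) * m / g) * (⌈((g : ℚ) * k / d)⌉₊ : ℚ)⌉₊
        ≤ padicValNat p (artinSchreierCount q f)) ∧
    (g = 1 →
      (∀ f : MvPolynomial (Fin k) F, f.IsHomogeneous d →
        e * m * ⌈(k : ℚ) / d⌉₊ ≤ padicValNat p (artinSchreierCount q f)) ∧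
      ∃ f : MvPolynomial (Fin k) F, f ≠ 0 ∧ f.IsHomogeneous d ∧
        padicValNat p (artinSchreierCount q f) = e * m * ⌈(k : ℚ) / d⌉₊) := by
  subst hq hg
  have := Fintype.ofFinite F
  rw [Nat.card_eq_fintype_card] at hF
  have hcard : Fintype.card F = p ^ (e * m) := by rw [hF, pow_mul]
  set M := ((p ^ e) ^ m - 1) / (p ^ e - 1)
  have hM : M * (p ^ e - 1) = Fintype.card F - 1 := by
    rw [hF]
    exact Nat.div_mul_cancel (by simpa using Nat.sub_dvd_pow_sub_pow (p ^ e) 1 m)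
  have hbound {f : MvPolynomial (Fin k) F} (hf : f.IsHomogeneous d) :=
    mul_ceilDiv_le_mul_padicValNat hp hcard hd hM hf
  refine ⟨fun f hf => ?_, fun hg => ?_⟩
  · have hg : (0 : ℚ) < d.gcd M := Nat.cast_pos.2 (Nat.gcd_pos_of_pos_left _ hd)
    rw [← Nat.cast_mul (d.gcd M) k, natCeil_div_eq_ceilDiv hd, Nat.ceil_le, div_mul_eq_mul_div,
      div_le_iff₀' hg]
    exact_mod_cast hbound hf
  · simp only [hg, one_mul] at hbound
    simp only [natCeil_div_eq_ceilDiv hd]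
    exact ⟨fun f => hbound, exists_padicValNat_artinSchreierCount_eq hp hcard hk hd hg hM⟩
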